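/- Let $\mathbb T=\mathbb R^2/\mathbb Z^2$ and $Y=[0,1)^2$. For $\mathcal Z\subset\mathbb T$ let $Z\subset Y$ be its representative in $Y$, and let $Z^\#$ be the interior of $\bigcup_{k\in\mathbb Z^2}(k+\overline Z)$ in $\mathbb R^2$. Let $\mathcal Z_1,\mathcal Z_2$ be open subsets of $\mathbb T$ with $C^2$ boundary such that $\mathcal Z_1\cap\mathcal Z_2=\emptyset$, $\overline{\mathcal Z_1}\cup\overline{\mathcal Z_2}=\mathbb T$, the set $Z_2^\#$ has an unbounded connected component $X_2^\#$ with $X_2^\#\cap Y=Z_2$, and $\mathcal Z_1$ has finitely many connected components. Let $$\mathbb L(y)M=\lambda(y)\,\mathrm{tr}(M)\,I_2+\mu(y)\,(M+M^T),\qquad y\in\mathbb T,\ M\in\mathbb R^{2\times2}$$ (so that $\mathbb L(y)M=\lambda(y)\,\mathrm{tr}(M)I_2+2\mu(y)M$ for symmetric $M$), where $\lambda=\lambda_i$, $\mu=\mu_i$ in $\mathcal Z_i$ ($i=1,2$) for real constants with $$0<-\lambda_2-\mu_2=\mu_1<\mu_2,\qquad \lambda_1+\mu_1>0,$$ and extend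 $\mathbb L$ by $\mathbb Z^2$-periodicity to $\mathbb R^2$. Let $\Omega\subset\mathbb R^2$ be a bounded open set and, for $\varepsilon>0$ and $v\in L^2(\Omega;\mathbb R^2)$, let $$\mathscr I^\varepsilon(v)=\int_\Omega\big\{\mathbb L(x/\varepsilon)\nabla v\cdot\nabla v+|v|^2\big\}\,dx\ \text{ if } v\in H^1_0(\Omega;\mathbb R^2),\qquad \mathscr I^\varepsilon(v)=+\infty\ \text{ otherwise,}$$ where $A\cdot B=\mathrm{tr}(A^TB)$. Then there exist constants $\alpha_\varepsilon>0$, $\varepsilon>0$, such that for every $\varepsilon>0$ $$\mathscr I^\varepsilon(v)\ \ge\ \alpha_\varepsilon\int_\Omega\big\{|v|^2+|\nabla v|^2\big\}\,dx\qquad\text{for all } v\in H^1_0(\Omega;\mathbb R^2).$$ -/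

import Mathlib

open MeasureTheory
open scoped ContDiff

namespace TwoPhase

/-- The plane with its Euclidean norm. -/
abbrev Plane : Type := EuclideanSpace ℝ (Fin 2)

/-- Real two by two matrices. -/
abbrev Mat2 : Type := Matrix (Fin 2) (Fin 2) ℝ

/-- The two-dimensional torus, the product of two copies of `ℝ / ℤ`. -/
abbrev Torus2 : Type := UnitAddTorus (Fin 2)

/-! ### Subsets of the torus and their representatives in the plane -/

/-- The canonical projection of the plane onto the torus. -/
def toTorus (x : Plane) : Torus2 := fun i => ((x i : ℝ) : UnitAddCircle)

/-- The unit cell `[0,1)²`. -/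
def unitCell : Set Plane := {x | ∀ i, x i ∈ Set.Ico (0 : ℝ) 1}

/-- The representative in the unit cell of a subset of the torus. -/
def cellRep (Z : Set Torus2) : Set Plane := {x | x ∈ unitCell ∧ toTorus x ∈ Z}

/-- The point of the plane with the given integer coordinates. -/
def latticePoint (k : Fin 2 → ℤ) : Plane := WithLp.toLp 2 (fun i => (k i : ℝ))

/-- The open periodic representative in the plane of a subset of the torus: the interior of the
union of all the integer translates of the closure of its representative in the unit cell. -/
def periodicRep (Z : Set Torus2) : Set Plane :=
  interior (⋃ k : Fin 2 → ℤ, (fun y => latticePoint k + y) '' closure (cellRep Z))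

/-- A subset of the plane has `C²` boundary: near each boundary point, after relabelling and
reorienting the coordinate axes if necessary, it is the strict epigraph of a `C²` function of
one variable. -/
def HasC2Boundary (S : Set Plane) : Prop :=
  ∀ x ∈ frontier S, ∃ r : ℝ, 0 < r ∧ ∃ i j : Fin 2, i ≠ j ∧ ∃ s : ℝ, (s = 1 ∨ s = -1) ∧
    ∃ γ : ℝ → ℝ, ContDiff ℝ 2 γ ∧ ∀ y ∈ Metric.ball x r, (y ∈ S ↔ γ (y i) < s * y j)

/-- A `C²` open subset of the torus (the projection of the plane onto the torus is a local
diffeomorphism, so regularity is read off on the preimage). -/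
def IsC2Open (Z : Set Torus2) : Prop :=
  IsOpen Z ∧ HasC2Boundary (toTorus ⁻¹' Z)

/-- The assumptions on the geometry of the two phases. -/
structure Geometry (Z₁ Z₂ : Set Torus2) : Prop where
  c2_one : IsC2Open Z₁
  c2_two : IsC2Open Z₂
  disjoint : Z₁ ∩ Z₂ = ∅
  cover : closure Z₁ ∪ closure Z₂ = Set.univ
  /-- The periodic representative of phase 2 has an unbounded connected component whose trace
  on the unit cell is the representative of phase 2. -/
  unbounded_component : ∃ x ∈ periodicRep Z₂,
    ¬ Bornology.IsBounded (connectedComponentIn (periodicRep Z₂) x) ∧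
    connectedComponentIn (periodicRep Z₂) x ∩ unitCell = cellRep Z₂
  finite_components : Finite (ConnectedComponents Z₁)

/-! ### The elasticity tensor -/

/-- The Frobenius inner product of matrices. -/
def frob (A B : Mat2) : ℝ := (A.transpose * B).trace

/-- The isotropic Hooke law with Lamé coefficients `l`, `m`. It acts on a matrix through the
symmetric part; on a symmetric `M` it is `l (tr M) I + 2 m M`. -/
def hooke (l m : ℝ) (M : Mat2) : Mat2 :=
  (l * M.trace) • (1 : Mat2) + m • (M + M.transpose)

/-- The assumptions on the Lamé coefficients `lam`, `mu` of the two-phase material, functions on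
the torus that are constant in each phase (nothing is said on the common interface). -/
structure Lame (Z₁ Z₂ : Set Torus2) (lam mu : Torus2 → ℝ) (lam₁ lam₂ mu₁ mu₂ : ℝ) :
    Prop where
  phase_one : ∀ y ∈ Z₁, lam y = lam₁ ∧ mu y = mu₁
  phase_two : ∀ y ∈ Z₂, lam y = lam₂ ∧ mu y = mu₂
  pos : 0 < -lam₂ - mu₂
  eq : -lam₂ - mu₂ = mu₁
  lt : mu₁ < mu₂
  very_strong : 0 < lam₁ + mu₁

/-! ### Sobolev spaces -/

/-- The `j`-th vector of the standard basis. -/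
noncomputable def basisVec (j : Fin 2) : Plane := EuclideanSpace.single j (1 : ℝ)

/-- `g` is the weak partial derivative of `u` in the direction `j` on `Ω`. -/
def HasWeakPartial (Ω : Set Plane) (u : Plane → ℝ) (j : Fin 2) (g : Plane → ℝ) : Prop :=
  ∀ φ : Plane → ℝ, ContDiff ℝ ∞ φ → HasCompactSupport φ → tsupport φ ⊆ Ω →
    ∫ x in Ω, u x * fderiv ℝ φ x (basisVec j) = - ∫ x in Ω, g x * φ x

/-- `G` is a square integrable weak gradient of the vector field `v` on `Ω`; the entry `i j` is
the weak derivative of the `i`-th component in the direction `j`. -/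
def IsL2WeakGrad (Ω : Set Plane) (v : Plane → Plane) (G : Plane → Mat2) : Prop :=
  ∀ i j, HasWeakPartial Ω (fun x => v x i) j (fun x => G x i j) ∧
    MemLp (fun x => G x i j) 2 (volume.restrict Ω)

/-- The space `L²(Ω; ℝ²)`. -/
abbrev L2 (Ω : Set Plane) : Type := Lp Plane 2 (volume.restrict Ω)

/-- The space `H¹(Ω; ℝ²)`, as a subset of `L²(Ω; ℝ²)`. -/
def H1 (Ω : Set Plane) : Set (L2 Ω) := {v | ∃ G, IsL2WeakGrad Ω v G}

open Classical in
/-- The weak gradient of an element of `H¹(Ω; ℝ²)` (unique up to null sets); zero outside of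
that space. -/
noncomputable def weakGrad (Ω : Set Plane) (v : L2 Ω) : Plane → Mat2 :=
  if h : ∃ G, IsL2WeakGrad Ω v G then h.choose else 0

/-- The Jacobian matrix of a differentiable vector field. -/
noncomputable def jacobian (φ : Plane → Plane) (x : Plane) : Mat2 :=
  Matrix.of fun i j => (fderiv ℝ φ x (basisVec j)) i

/-- The space `H¹₀(Ω; ℝ²)`: the closure in `H¹(Ω; ℝ²)` of the smooth vector fields with compact
support in `Ω`. -/
def H10 (Ω : Set Plane) : Set (L2 Ω) :=
  {v | v ∈ H1 Ω ∧ ∀ δ : ℝ, 0 < δ → ∃ φ : Plane → Plane,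
    ContDiff ℝ ∞ φ ∧ HasCompactSupport φ ∧ tsupport φ ⊆ Ω ∧
    ∫ x in Ω, (‖v x - φ x‖ ^ 2 +
      frob (weakGrad Ω v x - jacobian φ x) (weakGrad Ω v x - jacobian φ x)) < δ}

/-! ### The functional -/

open Classical in
/-- The functional `v ↦ ∫_Ω (𝕃(x/ε) ∇v · ∇v + |v|²) dx` on `H¹₀(Ω; ℝ²)`, extended by `∞` to
`L²(Ω; ℝ²)`. -/
noncomputable def energy (Ω : Set Plane) (lam mu : Torus2 → ℝ) (ε : ℝ) (v : L2 Ω) : EReal :=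
  if v ∈ H10 Ω then
    ((∫ x in Ω, (frob (hooke (lam (toTorus (ε⁻¹ • x))) (mu (toTorus (ε⁻¹ • x)))
        (weakGrad Ω v x)) (weakGrad Ω v x) + ‖v x‖ ^ 2) : ℝ) : EReal)
  else ⊤

end TwoPhase

/-! The determinant is a null Lagrangian: `∫ det ∇φ = 0` for smooth compactly supported φ
(`integral_det_jacobian`). So `4 μ₁ det ∇φ` may be added to the density without changing the energy,
and the new density is a combination of squares (`frob_hooke_add_det`). In phase 1 it is `(λ₁ +
2μ₁)(tr M)² + μ₁(M₀₁ - M₁₀)²`, with positive coefficients, and it dominates `|M|² + 2 det M = (tr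
M)² + (M₀₁ - M₁₀)²`. In phase 2 the relation `-λ₂ - μ₂ = μ₁` cancels the trace term; since `0 < μ₁ <
μ₂`, what is left controls M modulo multiples of the identity (`devSq`). As `|M|² + 2 det M` and
`|M|²` have the same integral, all of ∇φ is controlled as soon as its restriction to phase 2 is.

The missing ingredient is a Korn inequality in phase 2: `∫ |∇v|²` is bounded by `∫ (devSq ∇v +
|v|²)`, with no boundary condition on the interface. Compactness and cutoffs
(`korn_of_isLocalEpigraph`) reduce it to an epigraph, and a shear flattens this to the half-plane
(`epigraph_korn`). There the single uncontrolled quantity is `b = ∂ₜf₂`; up to controlled errors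
`∂ₓf₁ = b`, so the Jacobian determinant of `(f₁, f₂)` is close to `b²`. Its integral depends only on
the traces. A second pair with the same traces, built by combining the fields with their dilations,
has determinant close to minus a square. Comparing the two integrals bounds `∫ b²`
(`upperHalf_korn`).

Coercivity on smooth fields (`coercive_smooth`) passes to `H¹₀` by density (`coercive_of_smooth`).
The interface is null, so values of the coefficients there are irrelevant. -/

namespace TwoPhase

/-! ### Calculus on the upper half-plane -/

/-- The open upper half-plane. -/
def upperHalf : Set (ℝ × ℝ) := Set.univ ×ˢ Set.Ioi (0 : ℝ)

lemma hasCompactSupport_slice_right {h : ℝ × ℝ → ℝ} (hc : HasCompactSupport h) (x : ℝ) :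
    HasCompactSupport (fun t => h (x, t)) := by
  have he : Topology.IsClosedEmbedding (fun t : ℝ => (x, t)) := by
    refine Topology.IsClosedEmbedding.of_continuous_injective_isClosedMap (by fun_prop)
      (fun a b hab => (Prod.mk.inj hab).2) (fun C hC => ?_)
    have : (fun t : ℝ => (x, t)) '' C = {x} ×ˢ C := by
      ext ⟨a, b⟩; simp; tauto
    rw [this]
    exact isClosed_singleton.prod hC
  exact hc.comp_isClosedEmbedding he

lemma hasCompactSupport_slice_left {h : ℝ × ℝ → ℝ} (hc : HasCompactSupport h) (t : ℝ) :
    HasCompactSupport (fun x => h (x, t)) := by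
  have := hc.comp_homeomorph (Homeomorph.prodComm ℝ ℝ)
  exact hasCompactSupport_slice_right this t

lemma setIntegral_upperHalf {h : ℝ × ℝ → ℝ} (h0 : Continuous h) (hc : HasCompactSupport h) :
    ∫ p in upperHalf, h p = ∫ x, ∫ t in Set.Ioi (0 : ℝ), h (x, t) := by
  have := setIntegral_prod (μ := (volume : Measure ℝ)) (ν := (volume : Measure ℝ))
    (s := Set.univ) (t := Set.Ioi (0 : ℝ)) h
    (h0.integrable_of_hasCompactSupport hc).integrableOn
  rw [Measure.restrict_univ] at this
  exact this

lemma setIntegral_upperHalf_swap {h : ℝ × ℝ → ℝ} (h0 : Continuous h)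
    (hc : HasCompactSupport h) :
    ∫ p in upperHalf, h p = ∫ t in Set.Ioi (0 : ℝ), ∫ x, h (x, t) := by
  have hi : Integrable h ((volume : Measure ℝ).prod (volume.restrict (Set.Ioi (0 : ℝ)))) := by
    have := (h0.integrable_of_hasCompactSupport (μ := volume) hc).integrableOn (s := upperHalf)
    rw [IntegrableOn, upperHalf, Measure.volume_eq_prod, ← Measure.prod_restrict,
      Measure.restrict_univ] at this
    exact this
  rw [← integral_prod_symm h hi, upperHalf, Measure.volume_eq_prod, ← Measure.prod_restrict,
      Measure.restrict_univ]

lemma hasDerivAt_slice_right {h : ℝ × ℝ → ℝ} (h1 : ContDiff ℝ 1 h) (x t : ℝ) :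
    HasDerivAt (fun t => h (x, t)) (fderiv ℝ h (x, t) (0, 1)) t := by
  have hd := (h1.differentiable (by norm_num) (x, t)).hasFDerivAt
  have : HasDerivAt (fun t : ℝ => (x, t)) ((0 : ℝ), (1 : ℝ)) t :=
    (hasDerivAt_const t x).prodMk (hasDerivAt_id t)
  exact hd.comp_hasDerivAt t this

lemma hasDerivAt_slice_left {h : ℝ × ℝ → ℝ} (h1 : ContDiff ℝ 1 h) (x t : ℝ) :
    HasDerivAt (fun x => h (x, t)) (fderiv ℝ h (x, t) (1, 0)) x := by
  have hd := (h1.differentiable (by norm_num) (x, t)).hasFDerivAt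
  have : HasDerivAt (fun x : ℝ => (x, t)) ((1 : ℝ), (0 : ℝ)) x :=
    (hasDerivAt_id x).prodMk (hasDerivAt_const x t)
  exact hd.comp_hasDerivAt x this

lemma continuous_fderiv_apply {E F : Type*} [NormedAddCommGroup E] [NormedSpace ℝ E]
    [NormedAddCommGroup F] [NormedSpace ℝ F] {h : E → F}
    (h1 : ContDiff ℝ 1 h) (v : E) : Continuous (fun p => fderiv ℝ h p v) :=
  (h1.continuous_fderiv (by norm_num)).clm_apply continuous_const

lemma setIntegral_upperHalf_fderiv_normal {h : ℝ × ℝ → ℝ} (h1 : ContDiff ℝ 1 h)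
    (hc : HasCompactSupport h) :
    ∫ p in upperHalf, fderiv ℝ h p (0, 1) = -∫ x, h (x, 0) := by
  rw [setIntegral_upperHalf (continuous_fderiv_apply h1 _) (hc.fderiv_apply ℝ _),
    ← integral_neg]
  congr 1
  ext x
  have h2 : ContDiff ℝ 1 (fun t => h (x, t)) := h1.comp (by fun_prop)
  rw [← HasCompactSupport.integral_Ioi_deriv_eq h2 (hasCompactSupport_slice_right hc x) 0]
  congr 1
  ext t
  exact (hasDerivAt_slice_right h1 x t).deriv.symm

lemma setIntegral_upperHalf_fderiv_tangent {h : ℝ × ℝ → ℝ} (h1 : ContDiff ℝ 1 h)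
    (hc : HasCompactSupport h) :
    ∫ p in upperHalf, fderiv ℝ h p (1, 0) = 0 := by
  rw [setIntegral_upperHalf_swap (continuous_fderiv_apply h1 _) (hc.fderiv_apply ℝ _)]
  refine integral_eq_zero_of_ae (Filter.Eventually.of_forall fun t => ?_)
  have hs := hasCompactSupport_slice_left hc t
  have hs' := hasCompactSupport_slice_left (hc.fderiv_apply ℝ (1, 0)) t
  refine integral_eq_zero_of_hasDerivAt_of_integrable
    (fun x => hasDerivAt_slice_left h1 x t) ?_ ?_
  · exact Continuous.integrable_of_hasCompactSupport
      ((continuous_fderiv_apply h1 _).comp (by fun_prop)) hs'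
  · exact Continuous.integrable_of_hasCompactSupport (h1.continuous.comp (by fun_prop)) hs

/-- The Jacobian determinant of the pair `(f, g)`. -/
noncomputable def jacDet (f g : ℝ × ℝ → ℝ) (p : ℝ × ℝ) : ℝ :=
  fderiv ℝ f p (1, 0) * fderiv ℝ g p (0, 1) - fderiv ℝ f p (0, 1) * fderiv ℝ g p (1, 0)

lemma continuous_jacDet {f g : ℝ × ℝ → ℝ} (hf : ContDiff ℝ 1 f) (hg : ContDiff ℝ 1 g) :
    Continuous (jacDet f g) :=
  ((continuous_fderiv_apply hf _).mul (continuous_fderiv_apply hg _)).sub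
    ((continuous_fderiv_apply hf _).mul (continuous_fderiv_apply hg _))

lemma hasCompactSupport_jacDet {f g : ℝ × ℝ → ℝ} (hf : HasCompactSupport f) :
    HasCompactSupport (jacDet f g) :=
  ((hf.fderiv_apply ℝ _).mul_right).sub ((hf.fderiv_apply ℝ _).mul_right)

/-- The Jacobian determinant is a null Lagrangian: its integral over the half-plane only depends
on the traces. -/
lemma setIntegral_upperHalf_jacDet {f g : ℝ × ℝ → ℝ} (hf : ContDiff ℝ 2 f) (hg : ContDiff ℝ 1 g)
    (hfc : HasCompactSupport f) :
    ∫ p in upperHalf, jacDet f g p = -∫ x, g (x, 0) * fderiv ℝ f (x, 0) (1, 0) := by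
  have hdf : ContDiff ℝ 1 (fderiv ℝ f) := hf.fderiv_right (by norm_num)
  have hx : ContDiff ℝ 1 (fun p => fderiv ℝ f p (1, 0)) := hdf.clm_apply contDiff_const
  have ht : ContDiff ℝ 1 (fun p => fderiv ℝ f p (0, 1)) := hdf.clm_apply contDiff_const
  have c1 : HasCompactSupport (fun p => g p * fderiv ℝ f p (1, 0)) :=
    (hfc.fderiv_apply ℝ _).mul_left
  have c2 : HasCompactSupport (fun p => g p * fderiv ℝ f p (0, 1)) :=
    (hfc.fderiv_apply ℝ _).mul_left
  have d1 : ContDiff ℝ 1 (fun p => g p * fderiv ℝ f p (1, 0)) := hg.mul hx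
  have d2 : ContDiff ℝ 1 (fun p => g p * fderiv ℝ f p (0, 1)) := hg.mul ht
  have e1 := setIntegral_upperHalf_fderiv_normal d1 c1
  have e2 := setIntegral_upperHalf_fderiv_tangent d2 c2
  -- Divergence form `fₓgₜ - fₜgₓ = ∂ₜ(g fₓ) - ∂ₓ(g fₜ)`. Only `f` is differentiated twice; this
  -- matters because `g` will be a reflected component containing the slope of the graph, which is
  -- merely C¹.
  have e3 : ∫ p in upperHalf, jacDet f g p
      = ∫ p in upperHalf, (fderiv ℝ (fun p => g p * fderiv ℝ f p (1, 0)) p (0, 1)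
        - fderiv ℝ (fun p => g p * fderiv ℝ f p (0, 1)) p (1, 0)) := by
    congr 1
    ext p
    have gd := hg.differentiable (by norm_num) p
    have second : ∀ v w : ℝ × ℝ, fderiv ℝ (fun p => fderiv ℝ f p v) p w
        = fderiv ℝ (fderiv ℝ f) p w v := by
      intro v w
      have := (hdf.differentiable (by norm_num) p).hasFDerivAt.clm_apply
        (hasFDerivAt_const v p)
      rw [this.fderiv]
      simp
    have hsymm : fderiv ℝ (fderiv ℝ f) p (0, 1) (1, 0) = fderiv ℝ (fderiv ℝ f) p (1, 0) (0, 1) :=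
      (hf.contDiffAt (x := p)).isSymmSndFDerivAt (by simp) _ _
    rw [fderiv_fun_mul gd (hx.differentiable (by norm_num) p),
      fderiv_fun_mul gd (ht.differentiable (by norm_num) p)]
    simp only [add_apply, smul_apply, smul_eq_mul, second, hsymm, jacDet]
    ring
  rw [e3, integral_sub, e1, e2, sub_zero]
  · exact ((continuous_fderiv_apply d1 _).integrable_of_hasCompactSupport
      (c1.fderiv_apply ℝ _)).integrableOn
  · exact ((continuous_fderiv_apply d2 _).integrable_of_hasCompactSupport
      (c2.fderiv_apply ℝ _)).integrableOn

/-- Dilation of the second variable by a factor two. -/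
noncomputable def dil : (ℝ × ℝ) ≃L[ℝ] (ℝ × ℝ) :=
  (ContinuousLinearEquiv.refl ℝ ℝ).prodCongr
    (ContinuousLinearEquiv.unitsEquivAut ℝ (Units.mk0 (2 : ℝ) two_ne_zero))

lemma dil_apply (p : ℝ × ℝ) : dil p = (p.1, 2 * p.2) := by
  ext <;> simp [dil, mul_comm]

lemma setIntegral_upperHalf_comp_dil {h : ℝ × ℝ → ℝ} (h0 : Continuous h)
    (hc : HasCompactSupport h) :
    ∫ p in upperHalf, h (dil p) = 2⁻¹ * ∫ p in upperHalf, h p := by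
  have hd : HasCompactSupport (fun p => h (dil p)) := hc.comp_homeomorph dil.toHomeomorph
  rw [setIntegral_upperHalf (h := fun p => h (dil p)) (h0.comp dil.continuous) hd,
    setIntegral_upperHalf h0 hc, ← integral_const_mul]
  congr 1
  ext x
  have := integral_comp_mul_left_Ioi (fun t => h (x, t)) 0 (two_pos (α := ℝ))
  simpa [dil_apply] using this

lemma fderiv_comp_dil {h : ℝ × ℝ → ℝ} (h1 : ContDiff ℝ 1 h) (p : ℝ × ℝ) :
    fderiv ℝ (fun q => h (dil q)) p (1, 0) = fderiv ℝ h (dil p) (1, 0) ∧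
    fderiv ℝ (fun q => h (dil q)) p (0, 1) = 2 * fderiv ℝ h (dil p) (0, 1) := by
  have := ((h1.differentiable (by norm_num) (dil p)).hasFDerivAt).comp p
    (dil : (ℝ × ℝ) →L[ℝ] (ℝ × ℝ)).hasFDerivAt
  have e : fderiv ℝ (fun q => h (dil q)) p = _ := this.fderiv
  rw [e]
  refine ⟨by simp [dil_apply], ?_⟩
  have h2 : dil ((0 : ℝ), (1 : ℝ)) = (2 : ℝ) • ((0 : ℝ), (1 : ℝ)) := by simp [dil_apply]
  simp only [ContinuousLinearMap.comp_apply, ContinuousLinearEquiv.coe_coe, h2, map_smul,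
    smul_eq_mul]

/-! ### A Korn type inequality in flattened coordinates -/

/-- The squares of the components of the gradient controlled in phase 2, in the coordinates which
flatten a graph of slope `g`, together with the square of the first component. -/
noncomputable def flatDev (g : ℝ → ℝ) (f₁ f₂ : ℝ × ℝ → ℝ) (p : ℝ × ℝ) : ℝ :=
  (fderiv ℝ f₁ p (0, 1)) ^ 2 +
  (fderiv ℝ f₂ p (1, 0) - g p.1 * fderiv ℝ f₂ p (0, 1)) ^ 2 +
  (fderiv ℝ f₁ p (1, 0) - g p.1 * fderiv ℝ f₁ p (0, 1) - fderiv ℝ f₂ p (0, 1)) ^ 2 +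
  f₁ p ^ 2

lemma continuous_flatDev {g : ℝ → ℝ} {f₁ f₂ : ℝ × ℝ → ℝ} (hg : Continuous g)
    (h₁ : ContDiff ℝ 1 f₁) (h₂ : ContDiff ℝ 1 f₂) : Continuous (flatDev g f₁ f₂) := by
  have a := continuous_fderiv_apply h₁ (0, 1)
  have b := continuous_fderiv_apply h₁ (1, 0)
  have c := continuous_fderiv_apply h₂ (0, 1)
  have d := continuous_fderiv_apply h₂ (1, 0)
  have e := h₁.continuous
  unfold flatDev
  fun_prop

lemma hasCompactSupport_flatDev {g : ℝ → ℝ} {f₁ f₂ : ℝ × ℝ → ℝ}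
    (h₁ : HasCompactSupport f₁) (h₂ : HasCompactSupport f₂) :
    HasCompactSupport (flatDev g f₁ f₂) := by
  have sq : ∀ h : ℝ × ℝ → ℝ, HasCompactSupport h → HasCompactSupport (fun p => h p ^ 2) :=
    fun h hh => hh.comp_left (g := fun x : ℝ => x ^ 2) (by norm_num)
  have a := h₁.fderiv_apply ℝ (0, 1)
  have b := h₁.fderiv_apply ℝ (1, 0)
  have c := h₂.fderiv_apply ℝ (0, 1)
  have d := h₂.fderiv_apply ℝ (1, 0)
  have ga : HasCompactSupport (fun p : ℝ × ℝ => g p.1 * fderiv ℝ f₁ p (0, 1)) := a.mul_left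
  have gc : HasCompactSupport (fun p : ℝ × ℝ => g p.1 * fderiv ℝ f₂ p (0, 1)) := c.mul_left
  exact (((sq _ a).add (sq _ (d.sub gc))).add (sq _ ((b.sub ga).sub c))).add (sq _ h₁)

lemma sq_add_four_le (a b c d : ℝ) :
    (a + b + c + d) ^ 2 ≤ 4 * (a ^ 2 + b ^ 2 + c ^ 2 + d ^ 2) := by
  nlinarith [sq_nonneg (a - b), sq_nonneg (a - c), sq_nonneg (a - d), sq_nonneg (b - c),
    sq_nonneg (b - d), sq_nonneg (c - d)]

/-- The algebraic inequality behind the reflection argument: primes denote values at the dilated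
point. -/
def ReflectionBound (M K : ℝ) : Prop :=
  ∀ g g' b p r s w b' p' r' s' w' : ℝ, |g| ≤ M → |g'| ≤ M →
      b ^ 2 / 2 - K * ((p ^ 2 + r ^ 2 + s ^ 2 + w ^ 2) + (p' ^ 2 + r' ^ 2 + s' ^ 2 + w' ^ 2)) ≤
      ((b + s + g * p) * b - p * (r + g * b)) -
      ((-3 * (b + s + g * p) + 4 * (b' + s' + g * p')) *
          (3 * b - 4 * b' - 6 * (g * (p - 2 * p'))) -
        (-3 * p + 8 * p') * (3 * (r + g * b) - 2 * (r' + g * b') - 6 * (g' * (w - w') +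
          g * ((b + s + g * p) - (b' + s' + g * p')))))

set_option maxHeartbeats 1000000 in
-- With `X = 3b - 4b'`, the right side is `b² + X²` plus products having a factor among `p, r, s, w`
-- and their primes. Products with `X` are absorbed by `X²`, the product `s b` by half of `b²`.
lemma exists_reflectionBound (M : ℝ) : ∃ K : ℝ, 0 ≤ K ∧
    ReflectionBound M K := by
  -- The slope enters at most twice in a product, as in `g * (g * p)`, hence the square of `1 + M ^
  -- 2`; the numerical factor is generous.
  refine ⟨100000 * (1 + M ^ 2) ^ 2, by positivity, ?_⟩
  intro g g' b p r s w b' p' r' s' w' hg hg'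
  set N := (p ^ 2 + r ^ 2 + s ^ 2 + w ^ 2) + (p' ^ 2 + r' ^ 2 + s' ^ 2 + w' ^ 2) with hN
  set T := (1 + M ^ 2) with hT
  have hg2 : g ^ 2 ≤ M ^ 2 := sq_le_sq' (by linarith [neg_abs_le g]) (le_trans (le_abs_self g) hg)
  have hg2' : g' ^ 2 ≤ M ^ 2 :=
    sq_le_sq' (by linarith [neg_abs_le g']) (le_trans (le_abs_self g') hg')
  have T1 : 1 ≤ T := by rw [hT]; nlinarith only [sq_nonneg M]
  have hN0 : 0 ≤ N := by positivity
  have q0 := sq_nonneg p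
  have q1 := sq_nonneg r
  have q2 := sq_nonneg s
  have q3 := sq_nonneg w
  have q0' := sq_nonneg p'
  have q1' := sq_nonneg r'
  have q2' := sq_nonneg s'
  have q3' := sq_nonneg w'
  have bp : p ^ 2 ≤ N := by rw [hN]; linarith
  have br : r ^ 2 ≤ N := by rw [hN]; linarith
  have bs : s ^ 2 ≤ N := by rw [hN]; linarith
  have bw : w ^ 2 ≤ N := by rw [hN]; linarith
  have bp' : p' ^ 2 ≤ N := by rw [hN]; linarith
  have br' : r' ^ 2 ≤ N := by rw [hN]; linarith
  have bs' : s' ^ 2 ≤ N := by rw [hN]; linarith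
  have bw' : w' ^ 2 ≤ N := by rw [hN]; linarith
  have mulB : ∀ c x X : ℝ, c ^ 2 ≤ T → x ^ 2 ≤ X → (c * x) ^ 2 ≤ T * X := by
    intro c x X hc hx
    rw [mul_pow]
    exact mul_le_mul hc hx (sq_nonneg x) (by linarith)
  have gT : g ^ 2 ≤ T := by linarith
  have gT' : g' ^ 2 ≤ T := by linarith
  have oneT : ∀ x : ℝ, x ^ 2 ≤ N → x ^ 2 ≤ T * N := fun x hx => by
    nlinarith only [hx, T1, hN0]
  have hp := oneT p bp
  have hp' := oneT p' bp'
  have hs := oneT s bs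
  have hs' := oneT s' bs'
  have hr := oneT r br
  have hr' := oneT r' br'
  have gp := mulB g p N gT bp
  have gp' := mulB g p' N gT bp'
  have gw := mulB g' w N gT' bw
  have gw' := mulB g' w' N gT' bw'
  have gs := mulB g s N gT bs
  have gs' := mulB g s' N gT bs'
  have ggp := mulB g (g * p) (T * N) gT gp
  have ggp' := mulB g (g * p') (T * N) gT gp'
  have hTN : 0 ≤ T * N := by positivity
  have up : ∀ x : ℝ, x ≤ T * N → x ≤ T * (T * N) := fun x hx => by
    nlinarith only [hx, T1, hTN]
  -- The gradient of the reflected pair `(u₁, u₂)`, with `X = 3b - 4b'`: `∂ₓu₁ = -X + e₁`, `∂ₜu₂ = X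
  -- + e₂`, `∂ₓu₂ = e₃ - g X`, `∂ₜu₁ = e₄`. The summands `0` only pad to four terms.
  obtain ⟨e₁, he₁⟩ : ∃ e, e = -3 * s + -3 * (g * p) + 4 * s' + 4 * (g * p') := ⟨_, rfl⟩
  obtain ⟨e₂, he₂⟩ : ∃ e, e = -6 * (g * p) + 12 * (g * p') + 0 + 0 := ⟨_, rfl⟩
  obtain ⟨e₃, he₃⟩ : ∃ e, e = (3 * r + -2 * r' + -6 * (g' * w) + 6 * (g' * w')) +
    (-6 * (g * s) + -6 * (g * (g * p)) + 6 * (g * s') + 6 * (g * (g * p'))) := ⟨_, rfl⟩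
  obtain ⟨e₄, he₄⟩ : ∃ e, e = -3 * p + 8 * p' + 0 + 0 := ⟨_, rfl⟩
  have h1 : e₁ ^ 2 ≤ 200 * (T * N) := by
    rw [he₁]; refine (sq_add_four_le _ _ _ _).trans ?_; linarith
  have h2 : e₂ ^ 2 ≤ 720 * (T * N) := by
    rw [he₂]; refine (sq_add_four_le _ _ _ _).trans ?_; linarith
  have h3 : e₃ ^ 2 ≤ 2000 * (T * (T * N)) := by
    rw [he₃]
    have i1 := sq_add_four_le (3 * r) (-2 * r') (-6 * (g' * w)) (6 * (g' * w'))
    have i2 := sq_add_four_le (-6 * (g * s)) (-6 * (g * (g * p))) (6 * (g * s'))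
      (6 * (g * (g * p')))
    have := up _ hr
    have := up _ hr'
    have := up _ gw
    have := up _ gw'
    have := up _ gs
    have := up _ gs'
    have := add_sq_le (a := 3 * r + -2 * r' + -6 * (g' * w) + 6 * (g' * w'))
      (b := -6 * (g * s) + -6 * (g * (g * p)) + 6 * (g * s') + 6 * (g * (g * p')))
    linarith
  have h4 : e₄ ^ 2 ≤ 292 * (T * N) := by
    rw [he₄]; refine (sq_add_four_le _ _ _ _).trans ?_; linarith
  have h5 : (g * e₄) ^ 2 ≤ 292 * (T * (T * N)) := by
    have := mulB g e₄ _ gT h4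
    linarith
  have h6 : (e₁ + -e₂ + g * e₄ + 0) ^ 2 ≤ 6000 * (T * (T * N)) := by
    refine (sq_add_four_le _ _ _ _).trans ?_
    have := up _ le_rfl
    linarith
  have key : ((b + s + g * p) * b - p * (r + g * b)) -
      ((-3 * (b + s + g * p) + 4 * (b' + s' + g * p')) *
          (3 * b - 4 * b' - 6 * (g * (p - 2 * p'))) -
        (-3 * p + 8 * p') * (3 * (r + g * b) - 2 * (r' + g * b') - 6 * (g' * (w - w') +
          g * ((b + s + g * p) - (b' + s' + g * p'))))) =
      b ^ 2 + (3 * b - 4 * b') ^ 2 + s * b - (3 * b - 4 * b') * (e₁ + -e₂ + g * e₄ + 0)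
        - p * r - e₁ * e₂ + e₃ * e₄ := by
    rw [he₁, he₂, he₃, he₄]; ring
  rw [key]
  have young : ∀ x y : ℝ, x * y ≤ x ^ 2 + y ^ 2 := fun x y => by
    nlinarith only [sq_nonneg (x - y), sq_nonneg x, sq_nonneg y]
  have f1 : -(s ^ 2 / 2 + b ^ 2 / 2) ≤ s * b := by nlinarith only [sq_nonneg (s + b)]
  have f2 := young (3 * b - 4 * b') (e₁ + -e₂ + g * e₄ + 0)
  have f3 := young p r
  have f4 := young e₁ e₂
  have f5 := young (-e₃) e₄
  rw [neg_mul, neg_sq] at f5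
  have := up _ le_rfl
  have e : 100000 * T ^ 2 * N = 100000 * (T * (T * N)) := by ring
  rw [e]
  linarith

lemma fderiv_reflect_fst {f₁ : ℝ × ℝ → ℝ} (h₁ : ContDiff ℝ 1 f₁) (p : ℝ × ℝ) :
    fderiv ℝ (fun q => -3 * f₁ q + 4 * f₁ (dil q)) p (1, 0) =
      -3 * fderiv ℝ f₁ p (1, 0) + 4 * fderiv ℝ f₁ (dil p) (1, 0) ∧
    fderiv ℝ (fun q => -3 * f₁ q + 4 * f₁ (dil q)) p (0, 1) =
      -3 * fderiv ℝ f₁ p (0, 1) + 8 * fderiv ℝ f₁ (dil p) (0, 1) := by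
  have d := h₁.differentiable (by norm_num) p
  have h₁' : ContDiff ℝ 1 (fun q => f₁ (dil q)) := h₁.comp dil.contDiff
  have d' := h₁'.differentiable (by norm_num) p
  obtain ⟨ex, et⟩ := fderiv_comp_dil h₁ p
  rw [fderiv_fun_add (d.const_mul _) (d'.const_mul _), fderiv_const_mul d, fderiv_const_mul d']
  simp only [add_apply, smul_apply, smul_eq_mul, ex, et]
  exact ⟨trivial, by ring⟩

lemma fderiv_reflect_snd {g : ℝ → ℝ} {f₁ f₂ : ℝ × ℝ → ℝ} (hg : ContDiff ℝ 1 g)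
    (h₁ : ContDiff ℝ 1 f₁) (h₂ : ContDiff ℝ 1 f₂) (p : ℝ × ℝ) :
    fderiv ℝ (fun q => 3 * f₂ q - 2 * f₂ (dil q) - 6 * (g q.1 * (f₁ q - f₁ (dil q)))) p (1, 0) =
      3 * fderiv ℝ f₂ p (1, 0) - 2 * fderiv ℝ f₂ (dil p) (1, 0) -
        6 * (deriv g p.1 * (f₁ p - f₁ (dil p)) +
          g p.1 * (fderiv ℝ f₁ p (1, 0) - fderiv ℝ f₁ (dil p) (1, 0))) ∧
    fderiv ℝ (fun q => 3 * f₂ q - 2 * f₂ (dil q) - 6 * (g q.1 * (f₁ q - f₁ (dil q)))) p (0, 1) =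
      3 * fderiv ℝ f₂ p (0, 1) - 4 * fderiv ℝ f₂ (dil p) (0, 1) -
        6 * (g p.1 * (fderiv ℝ f₁ p (0, 1) - 2 * fderiv ℝ f₁ (dil p) (0, 1))) := by
  have d := h₁.differentiable (by norm_num) p
  have h₁' : ContDiff ℝ 1 (fun q => f₁ (dil q)) := h₁.comp dil.contDiff
  have d' := h₁'.differentiable (by norm_num) p
  have k := h₂.differentiable (by norm_num) p
  have h₂' : ContDiff ℝ 1 (fun q => f₂ (dil q)) := h₂.comp dil.contDiff
  have k' := h₂'.differentiable (by norm_num) p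
  obtain ⟨ex, et⟩ := fderiv_comp_dil h₁ p
  obtain ⟨kx, kt⟩ := fderiv_comp_dil h₂ p
  have hgd : HasFDerivAt (fun q : ℝ × ℝ => g q.1)
      (deriv g p.1 • ContinuousLinearMap.fst ℝ ℝ ℝ) p :=
    (hg.differentiable (by norm_num) p.1).hasDerivAt.comp_hasFDerivAt p hasFDerivAt_fst
  have tot := ((k.hasFDerivAt.const_mul 3).sub (k'.hasFDerivAt.const_mul 2)).sub
    ((hgd.mul (d.hasFDerivAt.sub d'.hasFDerivAt)).const_mul 6)
  have e : fderiv ℝ (fun q => 3 * f₂ q - 2 * f₂ (dil q) - 6 * (g q.1 * (f₁ q - f₁ (dil q)))) p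
    = _ := tot.fderiv
  rw [e]
  simp [ex, et, kx, kt]
  constructor <;> ring

lemma jacDet_sub_jacDet_reflect_ge {M K : ℝ} (alg : ReflectionBound M K) {g : ℝ → ℝ}
    {f₁ f₂ : ℝ × ℝ → ℝ} (hg : ContDiff ℝ 1 g) (gM : ∀ x, |g x| ≤ M) (gM' : ∀ x, |deriv g x| ≤ M)
    (h₁ : ContDiff ℝ 1 f₁) (h₂ : ContDiff ℝ 1 f₂) (p : ℝ × ℝ) :
    (fderiv ℝ f₂ p (0, 1)) ^ 2 / 2 - K * (flatDev g f₁ f₂ p + flatDev g f₁ f₂ (dil p)) ≤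
      jacDet f₁ f₂ p - jacDet (fun q => -3 * f₁ q + 4 * f₁ (dil q))
        (fun q => 3 * f₂ q - 2 * f₂ (dil q) - 6 * (g q.1 * (f₁ q - f₁ (dil q)))) p := by
  have e1 : (dil p).1 = p.1 := by simp [dil_apply]
  -- Dictionary: `b = ∂ₜf₂`, `p = ∂ₜf₁`, `r = ∂ₓf₂ - g ∂ₜf₂`, `s = ∂ₓf₁ - g ∂ₜf₁ - ∂ₜf₂`, `w = f₁`.
  -- The dilation fixes the first coordinate, so the slope is the same at both points.
  have := alg (g p.1) (deriv g p.1) (fderiv ℝ f₂ p (0, 1)) (fderiv ℝ f₁ p (0, 1))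
    (fderiv ℝ f₂ p (1, 0) - g p.1 * fderiv ℝ f₂ p (0, 1))
    (fderiv ℝ f₁ p (1, 0) - g p.1 * fderiv ℝ f₁ p (0, 1) - fderiv ℝ f₂ p (0, 1)) (f₁ p)
    (fderiv ℝ f₂ (dil p) (0, 1)) (fderiv ℝ f₁ (dil p) (0, 1))
    (fderiv ℝ f₂ (dil p) (1, 0) - g p.1 * fderiv ℝ f₂ (dil p) (0, 1))
    (fderiv ℝ f₁ (dil p) (1, 0) - g p.1 * fderiv ℝ f₁ (dil p) (0, 1)
      - fderiv ℝ f₂ (dil p) (0, 1)) (f₁ (dil p)) (gM _) (gM' _)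
  unfold jacDet flatDev
  rw [(fderiv_reflect_fst h₁ p).1, (fderiv_reflect_fst h₁ p).2,
    (fderiv_reflect_snd hg h₁ h₂ p).1, (fderiv_reflect_snd hg h₁ h₂ p).2, e1]
  generalize fderiv ℝ f₁ p (1, 0) = a₁ at this ⊢
  generalize fderiv ℝ f₁ p (0, 1) = a₂ at this ⊢
  generalize fderiv ℝ f₂ p (1, 0) = a₃ at this ⊢
  generalize fderiv ℝ f₂ p (0, 1) = a₄ at this ⊢
  generalize fderiv ℝ f₁ (dil p) (1, 0) = b₁ at this ⊢
  generalize fderiv ℝ f₁ (dil p) (0, 1) = b₂ at this ⊢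
  generalize fderiv ℝ f₂ (dil p) (1, 0) = b₃ at this ⊢
  generalize fderiv ℝ f₂ (dil p) (0, 1) = b₄ at this ⊢
  linarith only [this]

lemma contDiff_reflect_snd {g : ℝ → ℝ} {f₁ f₂ : ℝ × ℝ → ℝ} (hg : ContDiff ℝ 1 g)
    (h₁ : ContDiff ℝ 1 f₁) (h₂ : ContDiff ℝ 1 f₂) :
    ContDiff ℝ 1 (fun q => 3 * f₂ q - 2 * f₂ (dil q) - 6 * (g q.1 * (f₁ q - f₁ (dil q)))) := by
  have a : ContDiff ℝ 1 (fun q => f₁ (dil q)) := h₁.comp dil.contDiff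
  have b : ContDiff ℝ 1 (fun q => f₂ (dil q)) := h₂.comp dil.contDiff
  have c : ContDiff ℝ 1 (fun q : ℝ × ℝ => g q.1) := hg.comp contDiff_fst
  fun_prop

/-- The coefficients `-3, 4` and `3, -2` are forced: each pair must sum to 1 to keep the trace, and
`∂ₜu₂` must be `-∂ₓu₁` to leading order, the dilation contributing a factor 2 to `∂ₜ`. The
correction `-6 g (f₁ - f₁ ∘ dil)` has zero trace and turns the `b`-part of `∂ₓu₂` into a multiple of
`3b - 4b'`. Its `x`-derivative produces `g' f₁`, which is why `flatDev` contains `f₁²` and `g'` must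
be bounded. -/
theorem upperHalf_korn (M : ℝ) : ∃ C : ℝ, 0 ≤ C ∧ ∀ (g : ℝ → ℝ) (f₁ f₂ : ℝ × ℝ → ℝ),
    ContDiff ℝ 1 g → (∀ x, |g x| ≤ M) → (∀ x, |deriv g x| ≤ M) →
    ContDiff ℝ 2 f₁ → ContDiff ℝ 2 f₂ → HasCompactSupport f₁ → HasCompactSupport f₂ →
    ∫ p in upperHalf, (fderiv ℝ f₂ p (0, 1)) ^ 2 ≤ C * ∫ p in upperHalf, flatDev g f₁ f₂ p := by
  obtain ⟨K, hK, alg⟩ := exists_reflectionBound M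
  -- The term at the dilated point integrates to half of the undilated one; the factor 2 undoes the
  -- halving of `b²`.
  refine ⟨2 * (K * (1 + 2⁻¹)), by positivity, ?_⟩
  intro g f₁ f₂ hg gM gM' h₁ h₂ c₁ c₂
  have h₁' : ContDiff ℝ 1 f₁ := h₁.of_le (by norm_num)
  have h₂' : ContDiff ℝ 1 f₂ := h₂.of_le (by norm_num)
  obtain ⟨u₁, hu₁⟩ : ∃ u : ℝ × ℝ → ℝ, u = fun q => -3 * f₁ q + 4 * f₁ (dil q) := ⟨_, rfl⟩
  obtain ⟨u₂, hu₂⟩ : ∃ u : ℝ × ℝ → ℝ, u = fun q => 3 * f₂ q - 2 * f₂ (dil q)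
    - 6 * (g q.1 * (f₁ q - f₁ (dil q))) := ⟨_, rfl⟩
  have cd₁ : HasCompactSupport (fun q => f₁ (dil q)) := c₁.comp_homeomorph dil.toHomeomorph
  have hd₁ : ContDiff ℝ 2 (fun q => f₁ (dil q)) := h₁.comp dil.contDiff
  have hd₂ : ContDiff ℝ 2 (fun q => f₂ (dil q)) := h₂.comp dil.contDiff
  have cu₁ : HasCompactSupport u₁ := by
    have a : HasCompactSupport (fun q => -3 * f₁ q) := c₁.mul_left
    have b : HasCompactSupport (fun q => 4 * f₁ (dil q)) := cd₁.mul_left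
    rw [hu₁]; exact a.add b
  have su₁ : ContDiff ℝ 2 u₁ := by
    rw [hu₁]; exact (contDiff_const.mul h₁).add (contDiff_const.mul hd₁)
  have su₂ : ContDiff ℝ 1 u₂ := by
    rw [hu₂]
    exact contDiff_reflect_snd hg h₁' h₂'
  have eqV := setIntegral_upperHalf_jacDet h₁ h₂' c₁
  have eqU := setIntegral_upperHalf_jacDet su₁ su₂ cu₁
  have trace : ∀ x : ℝ, dil (x, 0) = (x, 0) := fun x => by simp [dil_apply]
  -- Equal traces on `t = 0`, hence equal tangential derivatives there, give equal integrals of the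
  -- determinant.
  have eqUV : ∫ p in upperHalf, jacDet u₁ u₂ p = ∫ p in upperHalf, jacDet f₁ f₂ p := by
    rw [eqU, eqV]
    congr 2
    ext x
    rw [hu₁, (fderiv_reflect_fst h₁' (x, 0)).1, hu₂]
    simp only [trace]
    ring
  have iV : IntegrableOn (jacDet f₁ f₂) upperHalf :=
    ((continuous_jacDet h₁' h₂').integrable_of_hasCompactSupport
      (hasCompactSupport_jacDet c₁)).integrableOn
  have iU : IntegrableOn (jacDet u₁ u₂) upperHalf :=
    ((continuous_jacDet (su₁.of_le (by norm_num)) su₂).integrable_of_hasCompactSupport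
      (hasCompactSupport_jacDet cu₁)).integrableOn
  have cN := continuous_flatDev hg.continuous h₁' h₂'
  have sN : HasCompactSupport (flatDev g f₁ f₂) := hasCompactSupport_flatDev c₁ c₂
  have iN : IntegrableOn (flatDev g f₁ f₂) upperHalf :=
    (cN.integrable_of_hasCompactSupport sN).integrableOn
  have cN' : Continuous (fun p => flatDev g f₁ f₂ (dil p)) := cN.comp dil.continuous
  have sN' : HasCompactSupport (fun p => flatDev g f₁ f₂ (dil p)) :=
    sN.comp_homeomorph dil.toHomeomorph
  have iN' : IntegrableOn (fun p => flatDev g f₁ f₂ (dil p)) upperHalf :=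
    (cN'.integrable_of_hasCompactSupport sN').integrableOn
  have cB : Continuous (fun p => (fderiv ℝ f₂ p (0, 1)) ^ 2) := (continuous_fderiv_apply h₂' _).pow 2
  have sB : HasCompactSupport (fun p => (fderiv ℝ f₂ p (0, 1)) ^ 2) :=
    (c₂.fderiv_apply ℝ _).comp_left (g := fun x : ℝ => x ^ 2) (by norm_num)
  have iB : IntegrableOn (fun p => (fderiv ℝ f₂ p (0, 1)) ^ 2) upperHalf :=
    (cB.integrable_of_hasCompactSupport sB).integrableOn
  have point : ∀ p, (fderiv ℝ f₂ p (0, 1)) ^ 2 / 2 - K * (flatDev g f₁ f₂ p +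
      flatDev g f₁ f₂ (dil p)) ≤ jacDet f₁ f₂ p - jacDet u₁ u₂ p := fun p => by
    rw [hu₁, hu₂]
    exact jacDet_sub_jacDet_reflect_ge alg hg gM gM' h₁' h₂' p
  have iL : IntegrableOn (fun p => (fderiv ℝ f₂ p (0, 1)) ^ 2 / 2) upperHalf := iB.div_const 2
  have iS : IntegrableOn (fun p => flatDev g f₁ f₂ p + flatDev g f₁ f₂ (dil p)) upperHalf :=
    iN.add iN'
  have iR : IntegrableOn (fun p => K * (flatDev g f₁ f₂ p + flatDev g f₁ f₂ (dil p))) upperHalf :=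
    iS.const_mul K
  have iD : IntegrableOn (fun p => jacDet f₁ f₂ p - jacDet u₁ u₂ p) upperHalf := iV.sub iU
  have iLR : IntegrableOn (fun p => (fderiv ℝ f₂ p (0, 1)) ^ 2 / 2 -
      K * (flatDev g f₁ f₂ p + flatDev g f₁ f₂ (dil p))) upperHalf := iL.sub iR
  have int := integral_mono iLR iD point
  rw [integral_sub iL iR, integral_sub iV iU, eqUV, sub_self, integral_const_mul,
    integral_add iN iN', setIntegral_upperHalf_comp_dil cN sN, integral_div] at int
  linarith

/-! ### Flattening an epigraph -/

lemma eq_smul_add_smul {i j : Fin 2} (hij : i ≠ j) (y : Plane) :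
    y i • basisVec i + y j • basisVec j = y := by
  ext k
  fin_cases i <;> fin_cases j <;> fin_cases k <;> simp_all [basisVec]

/-- The homeomorphism of the plane onto itself which flattens the epigraph of `γ`. -/
noncomputable def flatten {i j : Fin 2} (hij : i ≠ j) {s : ℝ} (hs : s * s = 1) {γ : ℝ → ℝ}
    (hγ : Continuous γ) : Plane ≃ₜ ℝ × ℝ where
  toFun y := (y i, s * y j - γ (y i))
  invFun p := p.1 • basisVec i + (s * (γ p.1 + p.2)) • basisVec j
  left_inv y := by
    have : s * (γ (y i) + (s * y j - γ (y i))) = y j := by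
      linear_combination (y j) * hs
    simp only [this]
    exact eq_smul_add_smul hij y
  right_inv p := by
    have hi : (p.1 • basisVec i + (s * (γ p.1 + p.2)) • basisVec j) i = p.1 := by
      simp [basisVec, hij]
    have hj : (p.1 • basisVec i + (s * (γ p.1 + p.2)) • basisVec j) j = s * (γ p.1 + p.2) := by
      simp [basisVec, hij.symm]
    simp only [hi, hj]
    ext
    · rfl
    · linear_combination (γ p.1 + p.2) * hs
  continuous_toFun := by fun_prop
  continuous_invFun := by fun_prop

lemma measurePreserving_coords {i j : Fin 2} (hij : i ≠ j) :
    MeasurePreserving (fun y : Plane => (y i, y j)) := by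
  have h : MeasurePreserving (fun y : Plane => (y 0, y 1)) :=
    (volume_preserving_finTwoArrow ℝ).comp
      (EuclideanSpace.volume_preserving_symm_measurableEquiv_toLp (Fin 2))
  have h' : MeasurePreserving (fun y : Plane => (y 1, y 0)) :=
    Measure.measurePreserving_swap.comp h
  fin_cases i <;> fin_cases j
  · exact absurd rfl hij
  · exact h
  · exact h'
  · exact absurd rfl hij

/-- On each line with fixed first coordinate the map is a translation composed with a sign, so
Fubini suffices and no differentiability is needed. -/
lemma measurePreserving_flatten {i j : Fin 2} (hij : i ≠ j) {s : ℝ} (hs : s * s = 1)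
    {γ : ℝ → ℝ} (hγ : Continuous γ) : MeasurePreserving (flatten hij hs hγ) := by
  have hmap : ∀ a, Measure.map (fun b => s * b - γ a) (volume : Measure ℝ) = volume := by
    intro a
    have hneg : MeasurePreserving (fun b : ℝ => s * b) := by
      rcases mul_self_eq_one_iff.mp hs with rfl | rfl
      · simp only [one_mul]
        exact MeasurePreserving.id _
      · simpa using Measure.measurePreserving_neg (volume : Measure ℝ)
    exact ((measurePreserving_sub_right volume (γ a)).comp hneg).map_eq
  have hskew := (MeasurePreserving.id (volume : Measure ℝ)).skew_product
    (μc := (volume : Measure ℝ)) (μd := (volume : Measure ℝ)) (g := fun a b => s * b - γ a)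
    (by unfold Function.uncurry; fun_prop) (Filter.Eventually.of_forall hmap)
  exact hskew.comp (measurePreserving_coords hij)

/-- The strict epigraph of `γ` in the coordinates `y i`, `s * y j`. -/
def epigraph (i j : Fin 2) (s : ℝ) (γ : ℝ → ℝ) : Set Plane := {y | γ (y i) < s * y j}

lemma isOpen_epigraph (i j : Fin 2) (s : ℝ) {γ : ℝ → ℝ} (hγ : Continuous γ) :
    IsOpen (epigraph i j s γ) :=
  isOpen_lt (by fun_prop) (by fun_prop)

lemma setIntegral_epigraph {i j : Fin 2} (hij : i ≠ j) {s : ℝ} (hs : s * s = 1)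
    {γ : ℝ → ℝ} (hγ : Continuous γ) (F : ℝ × ℝ → ℝ) :
    ∫ y in epigraph i j s γ, F (flatten hij hs hγ y) = ∫ p in upperHalf, F p := by
  rw [← (measurePreserving_flatten hij hs hγ).setIntegral_preimage_emb
    (flatten hij hs hγ).measurableEmbedding F upperHalf]
  congr 2
  ext y
  simp [epigraph, upperHalf, flatten]

lemma volume_graph {i j : Fin 2} (hij : i ≠ j) {s : ℝ} (hs : s * s = 1)
    {γ : ℝ → ℝ} (hγ : Continuous γ) : volume {y : Plane | γ (y i) = s * y j} = 0 := by
  have h := (measurePreserving_flatten hij hs hγ).measure_preimage_emb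
    (flatten hij hs hγ).measurableEmbedding (Set.univ ×ˢ {0})
  have e : flatten hij hs hγ ⁻¹' (Set.univ ×ˢ {0}) = {y : Plane | γ (y i) = s * y j} := by
    ext y
    simp only [Set.mem_preimage, Set.mem_prod, Set.mem_univ, true_and, Set.mem_singleton_iff]
    change s * y j - γ (y i) = 0 ↔ γ (y i) = s * y j
    rw [sub_eq_zero]
    exact eq_comm
  rw [← e, h, Measure.volume_eq_prod, Measure.prod_prod]
  simp

lemma hasFDerivAt_flatten_symm {i j : Fin 2} (hij : i ≠ j) {s : ℝ} (hs : s * s = 1)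
    {γ : ℝ → ℝ} (hγ : ContDiff ℝ 2 γ) (p : ℝ × ℝ) :
    ∃ L : ℝ × ℝ →L[ℝ] Plane, HasFDerivAt (flatten hij hs hγ.continuous).symm L p ∧
      L (1, 0) = basisVec i + (s * deriv γ p.1) • basisVec j ∧ L (0, 1) = s • basisVec j := by
  have hg : HasFDerivAt (fun q : ℝ × ℝ => γ q.1)
      (deriv γ p.1 • ContinuousLinearMap.fst ℝ ℝ ℝ) p :=
    (hγ.differentiable (by norm_num) p.1).hasDerivAt.comp_hasFDerivAt p hasFDerivAt_fst
  refine ⟨_, ((hasFDerivAt_fst (𝕜 := ℝ) (p := p)).smul_const (basisVec i)).add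
    (((hg.add hasFDerivAt_snd).const_mul s).smul_const (basisVec j)), ?_, ?_⟩ <;> simp

lemma contDiff_flatten_symm {i j : Fin 2} (hij : i ≠ j) {s : ℝ} (hs : s * s = 1)
    {γ : ℝ → ℝ} (hγ : ContDiff ℝ 2 γ) :
    ContDiff ℝ 2 (flatten hij hs hγ.continuous).symm := by
  have h : ContDiff ℝ 2 (fun q : ℝ × ℝ => γ q.1) := hγ.comp contDiff_fst
  change ContDiff ℝ 2 (fun p : ℝ × ℝ => p.1 • basisVec i + (s * (γ p.1 + p.2)) • basisVec j)
  fun_prop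

/-! ### A Korn type inequality on epigraphs -/

lemma frob_self (M : Mat2) : frob M M = M 0 0 ^ 2 + M 0 1 ^ 2 + M 1 0 ^ 2 + M 1 1 ^ 2 := by
  simp [frob, Matrix.trace, Matrix.mul_apply, Fin.sum_univ_two]
  ring

/-- The sum of the squares of the entries of a matrix modulo the multiples of the identity. -/
def devSq (M : Mat2) : ℝ := (M 0 0 - M 1 1) ^ 2 + M 0 1 ^ 2 + M 1 0 ^ 2

lemma devSq_nonneg (M : Mat2) : 0 ≤ devSq M := by unfold devSq; positivity

lemma frob_self_nonneg (M : Mat2) : 0 ≤ frob M M := by rw [frob_self]; positivity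

lemma norm_sq_plane (y : Plane) : ‖y‖ ^ 2 = y 0 ^ 2 + y 1 ^ 2 := by
  rw [EuclideanSpace.norm_sq_eq, Fin.sum_univ_two]; simp

lemma devSq_eq {i j : Fin 2} (hij : i ≠ j) (M : Mat2) :
    devSq M = M i j ^ 2 + M j i ^ 2 + (M i i - M j j) ^ 2 := by
  fin_cases i <;> fin_cases j <;> simp_all [devSq] <;> ring

lemma frob_self_le {i j : Fin 2} (hij : i ≠ j) (M : Mat2) :
    frob M M ≤ 3 * M j j ^ 2 + 2 * devSq M := by
  have h : frob M M = M i i ^ 2 + M j j ^ 2 + M i j ^ 2 + M j i ^ 2 := by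
    rw [frob_self]
    fin_cases i <;> fin_cases j <;> simp_all <;> ring
  rw [h, devSq_eq hij]
  nlinarith [sq_nonneg (M i i - 2 * M j j), sq_nonneg (M i j), sq_nonneg (M j i)]

lemma continuous_jacobian {u : Plane → Plane} (hu : ContDiff ℝ 1 u) (i j : Fin 2) :
    Continuous (fun y => jacobian u y i j) := by
  have := continuous_fderiv_apply hu (basisVec j)
  simp only [jacobian, Matrix.of_apply]
  fun_prop

lemma jacobian_eq_zero {u : Plane → Plane} {y : Plane} (hy : y ∉ tsupport u) :
    jacobian u y = 0 := by
  have h : fderiv ℝ u y = 0 := by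
    by_contra h
    exact hy (support_fderiv_subset ℝ (Function.mem_support.mpr h))
  ext i j
  simp [jacobian, h]

lemma hasCompactSupport_jacobian_comp {u : Plane → Plane} (hc : HasCompactSupport u)
    {q : Plane → Mat2 → ℝ} (hq : ∀ y, q y 0 = 0) :
    HasCompactSupport (fun y => q y (jacobian u y)) :=
  HasCompactSupport.intro hc fun y hy => by rw [jacobian_eq_zero hy, hq]

lemma continuous_devSq_jacobian {u : Plane → Plane} (hu : ContDiff ℝ 1 u) :
    Continuous (fun y => devSq (jacobian u y)) := by
  have := continuous_jacobian hu
  unfold devSq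
  exact ((((this 0 0).sub (this 1 1)).pow 2).add ((this 0 1).pow 2)).add ((this 1 0).pow 2)

lemma continuous_frob_jacobian {u : Plane → Plane} (hu : ContDiff ℝ 1 u) :
    Continuous (fun y => frob (jacobian u y) (jacobian u y)) := by
  have := continuous_jacobian hu
  simp only [frob_self]
  exact ((((this 0 0).pow 2).add ((this 0 1).pow 2)).add ((this 1 0).pow 2)).add ((this 1 1).pow 2)

lemma hasCompactSupport_norm_sq {u : Plane → Plane} (hc : HasCompactSupport u) :
    HasCompactSupport (fun y => ‖u y‖ ^ 2) :=
  hc.comp_left (g := fun v : Plane => ‖v‖ ^ 2) (by simp)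

lemma integrable_devSq_add {u : Plane → Plane} (hu : ContDiff ℝ 1 u) (hc : HasCompactSupport u) :
    Integrable (fun y => devSq (jacobian u y) + ‖u y‖ ^ 2) := by
  have h1 : HasCompactSupport (fun y => devSq (jacobian u y)) :=
    hasCompactSupport_jacobian_comp (q := fun _ => devSq) hc (fun _ => by simp [devSq])
  have h2 : Continuous (fun y => ‖u y‖ ^ 2) := hu.continuous.norm.pow 2
  exact ((continuous_devSq_jacobian hu).integrable_of_hasCompactSupport h1).add
    (h2.integrable_of_hasCompactSupport (hasCompactSupport_norm_sq hc))

lemma integrable_frob {u : Plane → Plane} (hu : ContDiff ℝ 1 u) (hc : HasCompactSupport u) :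
    Integrable (fun y => frob (jacobian u y) (jacobian u y)) :=
  (continuous_frob_jacobian hu).integrable_of_hasCompactSupport
    (hasCompactSupport_jacobian_comp (q := fun _ M => frob M M) hc (fun _ => by simp [frob]))

lemma integrable_jacobian_sq {u : Plane → Plane} (hu : ContDiff ℝ 1 u)
    (hc : HasCompactSupport u) (i j : Fin 2) : Integrable (fun y => jacobian u y i j ^ 2) := by
  have h1 : HasCompactSupport (fun y => jacobian u y i j ^ 2) :=
    hasCompactSupport_jacobian_comp (q := fun _ M => M i j ^ 2) hc (fun _ => by simp)
  have h2 : Continuous (fun y => jacobian u y i j ^ 2) := (continuous_jacobian hu i j).pow 2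
  exact h2.integrable_of_hasCompactSupport h1

/-- The derivatives in flattened coordinates of the components of a vector field. -/
lemma fderiv_comp_flatten_symm {i j : Fin 2} (hij : i ≠ j) {s : ℝ} (hs : s * s = 1)
    {γ : ℝ → ℝ} (hγ : ContDiff ℝ 2 γ) {u : Plane → Plane} (hu : ContDiff ℝ 1 u) (k : Fin 2)
    (c : ℝ) (p : ℝ × ℝ) :
    fderiv ℝ (fun q => c * u ((flatten hij hs hγ.continuous).symm q) k) p (1, 0) =
      c * (jacobian u ((flatten hij hs hγ.continuous).symm p) k i +
        s * deriv γ p.1 * jacobian u ((flatten hij hs hγ.continuous).symm p) k j) ∧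
    fderiv ℝ (fun q => c * u ((flatten hij hs hγ.continuous).symm q) k) p (0, 1) =
      c * (s * jacobian u ((flatten hij hs hγ.continuous).symm p) k j) := by
  obtain ⟨L, hL, h1, h2⟩ := hasFDerivAt_flatten_symm hij hs hγ p
  have hu' := (hu.differentiable (by norm_num)
    ((flatten hij hs hγ.continuous).symm p)).hasFDerivAt.comp p hL
  have hk := (((EuclideanSpace.proj k : Plane →L[ℝ] ℝ).hasFDerivAt
    (x := u ((flatten hij hs hγ.continuous).symm p))).comp p hu').const_mul c
  have e : fderiv ℝ (fun q => c * u ((flatten hij hs hγ.continuous).symm q) k) p = _ := hk.fderiv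
  rw [e]
  simp only [smul_apply, ContinuousLinearMap.comp_apply, h1, h2, map_add, map_smul, smul_eq_mul,
    jacobian, Matrix.of_apply, EuclideanSpace.coe_proj, and_self]

/-- By `frob_self_le` only the entry `M j j` is missing, and in flattened coordinates it is the
`∂ₜf₂` of `upperHalf_korn`. Compact support of `γ` bounds `γ'` and `γ''`. -/
theorem epigraph_korn {i j : Fin 2} (hij : i ≠ j) {s : ℝ} (hs : s * s = 1)
    {γ : ℝ → ℝ} (hγ : ContDiff ℝ 2 γ) (hγc : HasCompactSupport γ) :
    ∃ C : ℝ, 0 ≤ C ∧ ∀ u : Plane → Plane, ContDiff ℝ ∞ u → HasCompactSupport u →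
      ∫ y in epigraph i j s γ, frob (jacobian u y) (jacobian u y) ≤
        C * ∫ y in epigraph i j s γ, (devSq (jacobian u y) + ‖u y‖ ^ 2) := by
  have hg : ContDiff ℝ 1 (deriv γ) := hγ.deriv'
  obtain ⟨M₁, hM₁⟩ := hγc.deriv.exists_bound_of_continuous hg.continuous
  obtain ⟨M₂, hM₂⟩ := hγc.deriv.deriv.exists_bound_of_continuous (hg.continuous_deriv (by norm_num))
  obtain ⟨C, hC, hkorn⟩ := upperHalf_korn (max M₁ M₂)
  refine ⟨3 * C + 2, by positivity, fun u hu hc => ?_⟩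
  obtain ⟨Φ, hΦ⟩ : ∃ Φ, Φ = flatten hij hs hγ.continuous := ⟨_, rfl⟩
  have hu1 : ContDiff ℝ 1 u := hu.of_le (by norm_num)
  have hu2 : ContDiff ℝ 2 u := hu.of_le (WithTop.coe_le_coe.mpr le_top)
  obtain ⟨f, hf⟩ : ∃ f : ℝ → Fin 2 → ℝ × ℝ → ℝ, f = fun c k q => c * u (Φ.symm q) k := ⟨_, rfl⟩
  have cf : ∀ c k, HasCompactSupport (f c k) := fun c k => by
    have h1 : HasCompactSupport (fun q => u (Φ.symm q)) := hc.comp_homeomorph Φ.symm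
    rw [hf]
    exact h1.comp_left (g := fun v : Plane => c * v k) (by simp)
  have sf : ∀ c k, ContDiff ℝ 2 (f c k) := fun c k => by
    have h1 : ContDiff ℝ 2 (fun q => u (Φ.symm q)) := by
      rw [hΦ]; exact hu2.comp (contDiff_flatten_symm hij hs hγ)
    rw [hf]
    exact contDiff_const.mul ((EuclideanSpace.proj k : Plane →L[ℝ] ℝ).contDiff.comp h1)
  have hder : ∀ c k y, fderiv ℝ (f c k) (Φ y) (1, 0) =
      c * (jacobian u y k i + s * deriv γ (Φ y).1 * jacobian u y k j) ∧
      fderiv ℝ (f c k) (Φ y) (0, 1) = c * (s * jacobian u y k j) := fun c k y => by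
    have := fderiv_comp_flatten_symm hij hs hγ hu1 k c (Φ y)
    rw [← hΦ, Homeomorph.symm_apply_apply] at this
    rw [hf]
    exact this
  -- The component `j` carries the factor `s` so that orientation cancels: `∂ₜf₂ = s² ∂ⱼuⱼ = ∂ⱼuⱼ`.
  have key := hkorn (deriv γ) (f 1 i) (f s j) hg (fun x => (hM₁ x).trans (le_max_left _ _))
    (fun x => (hM₂ x).trans (le_max_right _ _)) (sf _ _) (sf _ _) (cf _ _) (cf _ _)
  rw [← setIntegral_epigraph hij hs hγ.continuous, ← setIntegral_epigraph hij hs hγ.continuous,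
    ← hΦ] at key
  have e1 : ∀ y, fderiv ℝ (f s j) (Φ y) (0, 1) ^ 2 = jacobian u y j j ^ 2 := fun y => by
    rw [(hder s j y).2]
    linear_combination (jacobian u y j j ^ 2 * (s * s + 1)) * hs
  have e2 : ∀ y, flatDev (deriv γ) (f 1 i) (f s j) (Φ y) ≤ devSq (jacobian u y) + ‖u y‖ ^ 2 :=
      fun y => by
    have hi : u y i ^ 2 ≤ ‖u y‖ ^ 2 := by
      rw [norm_sq_plane]
      fin_cases i <;> simp [sq_nonneg]
    have h1 : f 1 i (Φ y) = u y i := by simp [hf]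
    rw [flatDev, devSq_eq hij, (hder _ _ _).1, (hder _ _ _).1, (hder _ _ _).2, (hder _ _ _).2, h1]
    refine le_trans (le_of_eq ?_) (add_le_add_right hi _)
    have e : s * (s * jacobian u y j j) = jacobian u y j j := by rw [← mul_assoc, hs, one_mul]
    have e' : s * (jacobian u y j i + s * deriv γ (Φ y).1 * jacobian u y j j) =
        s * jacobian u y j i + deriv γ (Φ y).1 * jacobian u y j j := by
      linear_combination (deriv γ (Φ y).1 * jacobian u y j j) * hs
    rw [e, e']
    linear_combination (jacobian u y i j ^ 2) * hs + (jacobian u y j i ^ 2) * hs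
  have iF := (integrable_frob hu1 hc).integrableOn (s := epigraph i j s γ)
  have iD := (integrable_devSq_add hu1 hc).integrableOn (s := epigraph i j s γ)
  have iJ : IntegrableOn (fun y => jacobian u y j j ^ 2) (epigraph i j s γ) :=
    (integrable_jacobian_sq hu1 hc j j).integrableOn
  have l1 : ∫ y in epigraph i j s γ, flatDev (deriv γ) (f 1 i) (f s j) (Φ y) ≤
      ∫ y in epigraph i j s γ, (devSq (jacobian u y) + ‖u y‖ ^ 2) :=
    integral_mono_of_nonneg (Filter.Eventually.of_forall fun y => by
      simp only [Pi.zero_apply, flatDev]; positivity) iD (Filter.Eventually.of_forall e2)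
  have l2 : ∫ y in epigraph i j s γ, frob (jacobian u y) (jacobian u y) ≤
      ∫ y in epigraph i j s γ, (3 * jacobian u y j j ^ 2 +
        2 * (devSq (jacobian u y) + ‖u y‖ ^ 2)) := by
    refine integral_mono iF ((iJ.const_mul 3).add (iD.const_mul 2)) fun y => ?_
    have := frob_self_le hij (jacobian u y)
    have := sq_nonneg ‖u y‖
    simp only
    linarith
  rw [integral_add (iJ.const_mul 3) (iD.const_mul 2), integral_const_mul, integral_const_mul] at l2
  simp only [e1] at key
  have := mul_le_mul_of_nonneg_left l1 hC
  linarith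

/-! ### Localisation -/

/-- Near `x` the set `S` is the strict epigraph of a `C²` function. -/
def IsLocalEpigraph (S : Set Plane) (x : Plane) : Prop :=
  ∃ r : ℝ, 0 < r ∧ ∃ i j : Fin 2, i ≠ j ∧ ∃ s : ℝ, s * s = 1 ∧ ∃ γ : ℝ → ℝ, ContDiff ℝ 2 γ ∧
    ∀ y ∈ Metric.ball x r, (y ∈ S ↔ y ∈ epigraph i j s γ)

lemma abs_coord_sub_lt {x y : Plane} {r : ℝ} (h : y ∈ Metric.ball x r) (i : Fin 2) :
    |y i - x i| < r := by
  have := PiLp.norm_apply_le (y - x) i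
  rw [Metric.mem_ball, dist_eq_norm] at h
  simpa using this.trans_lt h

/-- Away from the frontier a horizontal line just below (interior point) or just above (exterior
point) the ball serves as the graph. -/
lemma HasC2Boundary.isLocalEpigraph {S : Set Plane} (hS : HasC2Boundary S) (x : Plane) :
    IsLocalEpigraph S x := by
  by_cases hf : x ∈ frontier S
  · obtain ⟨r, hr, i, j, hij, s, hs, γ, hγ, h⟩ := hS x hf
    refine ⟨r, hr, i, j, hij, s, ?_, γ, hγ, h⟩
    rcases hs with rfl | rfl <;> norm_num
  by_cases hi : x ∈ interior S
  · obtain ⟨r, hr, h⟩ := Metric.isOpen_iff.mp isOpen_interior x hi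
    refine ⟨r, hr, 0, 1, by decide, 1, by norm_num, fun _ => x 1 - r, contDiff_const,
      fun y hy => ⟨fun _ => ?_, fun _ => interior_subset (h hy)⟩⟩
    have := (abs_lt.mp (abs_coord_sub_lt hy 1)).1
    change x 1 - r < 1 * y 1
    linarith
  · have hc : x ∉ closure S := fun hc => hf ⟨hc, hi⟩
    obtain ⟨r, hr, h⟩ := Metric.isOpen_iff.mp isClosed_closure.isOpen_compl x hc
    refine ⟨r, hr, 0, 1, by decide, 1, by norm_num, fun _ => x 1 + r, contDiff_const,
      fun y hy => ⟨fun hy' => absurd (subset_closure hy') (h hy), fun hy' => ?_⟩⟩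
    have := (abs_lt.mp (abs_coord_sub_lt hy 1)).2
    change x 1 + r < 1 * y 1 at hy'
    linarith

lemma IsLocalEpigraph.preimage_smul {S : Set Plane} {ε : ℝ} (hε : 0 < ε) {x : Plane}
    (h : IsLocalEpigraph S (ε⁻¹ • x)) : IsLocalEpigraph ((fun y => ε⁻¹ • y) ⁻¹' S) x := by
  obtain ⟨r, hr, i, j, hij, s, hs, γ, hγ, h⟩ := h
  refine ⟨ε * r, by positivity, i, j, hij, s, hs, fun t => ε * γ (ε⁻¹ * t),
    contDiff_const.mul (hγ.comp (contDiff_const.mul contDiff_id)), fun y hy => ?_⟩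
  have hy' : ε⁻¹ • y ∈ Metric.ball (ε⁻¹ • x) r := by
    rw [Metric.mem_ball, dist_smul₀, Real.norm_of_nonneg (by positivity), inv_mul_lt_iff₀ hε]
    exact hy
  rw [Set.mem_preimage, h _ hy']
  change γ (ε⁻¹ * y i) < s * (ε⁻¹ * y j) ↔ ε * γ (ε⁻¹ * y i) < s * y j
  rw [← mul_lt_mul_iff_right₀ hε]
  have : ε * (s * (ε⁻¹ * y j)) = s * y j := by field_simp
  rw [this]

/-- The function in `IsLocalEpigraph` can be taken with compact support. -/
lemma IsLocalEpigraph.exists_hasCompactSupport {S : Set Plane} {x : Plane}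
    (h : IsLocalEpigraph S x) :
    ∃ r : ℝ, 0 < r ∧ ∃ i j : Fin 2, i ≠ j ∧ ∃ s : ℝ, s * s = 1 ∧ ∃ γ : ℝ → ℝ, ContDiff ℝ 2 γ ∧
      HasCompactSupport γ ∧ ∀ y ∈ Metric.ball x r, (y ∈ S ↔ y ∈ epigraph i j s γ) := by
  obtain ⟨r, hr, i, j, hij, s, hs, γ, hγ, h⟩ := h
  let χ : ContDiffBump (x i) := ⟨r, 2 * r, hr, by linarith⟩
  refine ⟨r, hr, i, j, hij, s, hs, fun t => χ t * γ t, χ.contDiff.mul hγ,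
    χ.hasCompactSupport.mul_right, fun y hy => ?_⟩
  have h1 : χ (y i) = 1 := by
    refine χ.one_of_mem_closedBall ?_
    rw [Metric.mem_closedBall, Real.dist_eq]
    exact (abs_coord_sub_lt hy i).le
  rw [h y hy]
  simp only [epigraph, Set.mem_ofPred_eq, h1, one_mul]

lemma jacobian_smul {ζ : Plane → ℝ} {v : Plane → Plane} (hζ : ContDiff ℝ 1 ζ)
    (hv : ContDiff ℝ 1 v) (y : Plane) (i j : Fin 2) :
    jacobian (fun y => ζ y • v y) y i j =
      ζ y * jacobian v y i j + fderiv ℝ ζ y (basisVec j) * v y i := by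
  have e : fderiv ℝ (fun y => ζ y • v y) y = _ :=
    ((hζ.differentiable (by norm_num) y).hasFDerivAt.smul
      (hv.differentiable (by norm_num) y).hasFDerivAt).fderiv
  simp [jacobian, e]

/-- A cutoff costs only terms of order zero in `v`, absorbed by `‖v‖ ^ 2`. In the constant, 3 comes
from the three-term square of the diagonal difference and `5 = 3 + 2` collects the diagonal and
off-diagonal contributions of `∇ζ`. -/
lemma devSq_jacobian_smul_le {ζ : Plane → ℝ} {v : Plane → Plane} (hζ : ContDiff ℝ 1 ζ)
    (hv : ContDiff ℝ 1 v) {B : ℝ} (y : Plane) (h1 : |ζ y| ≤ 1)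
    (hB : ∀ j, |fderiv ℝ ζ y (basisVec j)| ≤ B) :
    devSq (jacobian (fun y => ζ y • v y) y) + ‖ζ y • v y‖ ^ 2 ≤
      (3 + 5 * B ^ 2) * (devSq (jacobian v y) + ‖v y‖ ^ 2) := by
  have hz : ζ y ^ 2 ≤ 1 := by
    rw [← sq_abs]; exact pow_le_one₀ (abs_nonneg _) h1
  have hb : ∀ j, (fderiv ℝ ζ y (basisVec j)) ^ 2 ≤ B ^ 2 := fun j => by
    rw [← sq_abs]; exact pow_le_pow_left₀ (abs_nonneg _) (hB j) 2
  have b0 := hb 0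
  have b1 := hb 1
  rw [norm_smul, mul_pow, Real.norm_eq_abs, sq_abs]
  simp only [devSq, jacobian_smul hζ hv, norm_sq_plane]
  generalize fderiv ℝ ζ y (basisVec 0) = z₀ at *
  generalize fderiv ℝ ζ y (basisVec 1) = z₁ at *
  generalize jacobian v y 0 0 = a
  generalize jacobian v y 0 1 = b
  generalize jacobian v y 1 0 = c
  generalize jacobian v y 1 1 = d
  generalize v y 0 = v₀
  generalize v y 1 = v₁
  generalize ζ y = z at *
  have mulB : ∀ t X w : ℝ, t ^ 2 ≤ X → (t * w) ^ 2 ≤ X * w ^ 2 := fun t X w h => by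
    rw [mul_pow]; exact mul_le_mul_of_nonneg_right h (sq_nonneg w)
  have three : ∀ p q r : ℝ, (p + q - r) ^ 2 ≤ 3 * (p ^ 2 + q ^ 2 + r ^ 2) := fun p q r => by
    nlinarith only [sq_nonneg (p - q), sq_nonneg (p + r), sq_nonneg (q + r)]
  have two : ∀ p q : ℝ, (p + q) ^ 2 ≤ 2 * (p ^ 2 + q ^ 2) := fun p q => by
    nlinarith only [sq_nonneg (p - q)]
  have e1 : (z * a + z₀ * v₀ - (z * d + z₁ * v₁)) ^ 2 ≤
      3 * ((a - d) ^ 2 + B ^ 2 * v₀ ^ 2 + B ^ 2 * v₁ ^ 2) := by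
    have := three (z * (a - d)) (z₀ * v₀) (z₁ * v₁)
    have := mulB z 1 (a - d) hz
    have := mulB z₀ _ v₀ b0
    have := mulB z₁ _ v₁ b1
    have e : z * a + z₀ * v₀ - (z * d + z₁ * v₁) = z * (a - d) + z₀ * v₀ - z₁ * v₁ := by ring
    rw [e]; linarith
  have e2 : (z * b + z₁ * v₀) ^ 2 ≤ 2 * (b ^ 2 + B ^ 2 * v₀ ^ 2) := by
    have := two (z * b) (z₁ * v₀)
    have := mulB z 1 b hz
    have := mulB z₁ _ v₀ b1
    linarith
  have e3 : (z * c + z₀ * v₁) ^ 2 ≤ 2 * (c ^ 2 + B ^ 2 * v₁ ^ 2) := by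
    have := two (z * c) (z₀ * v₁)
    have := mulB z 1 c hz
    have := mulB z₀ _ v₁ b0
    linarith
  have e4 : z ^ 2 * (v₀ ^ 2 + v₁ ^ 2) ≤ v₀ ^ 2 + v₁ ^ 2 := by
    have := mul_le_mul_of_nonneg_right hz (by positivity : 0 ≤ v₀ ^ 2 + v₁ ^ 2)
    linarith
  have p1 : 0 ≤ B ^ 2 * (a - d) ^ 2 := by positivity
  have p2 : 0 ≤ B ^ 2 * b ^ 2 := by positivity
  have p3 : 0 ≤ B ^ 2 * c ^ 2 := by positivity
  have p4 : 0 ≤ B ^ 2 * v₀ ^ 2 := by positivity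
  have p5 : 0 ≤ B ^ 2 * v₁ ^ 2 := by positivity
  nlinarith only [e1, e2, e3, e4, p1, p2, p3, p4, p5, sq_nonneg b, sq_nonneg c, sq_nonneg v₀,
    sq_nonneg v₁]

lemma IsLocalEpigraph.korn {S : Set Plane} (hS : MeasurableSet S) {x : Plane}
    (h : IsLocalEpigraph S x) :
    ∃ ρ : ℝ, 0 < ρ ∧ ∃ C : ℝ, 0 ≤ C ∧
      ∀ v : Plane → Plane, ContDiff ℝ ∞ v → HasCompactSupport v →
        ∫ y in S ∩ Metric.ball x ρ, frob (jacobian v y) (jacobian v y) ≤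
          C * ∫ y in S, (devSq (jacobian v y) + ‖v y‖ ^ 2) := by
  obtain ⟨r, hr, i, j, hij, s, hs, γ, hγ, hγc, h⟩ := h.exists_hasCompactSupport
  obtain ⟨C, hC, hkorn⟩ := epigraph_korn hij hs hγ hγc
  -- `ζ = 1` on the ball of radius `r / 3`, where the gradient is to be estimated; its support lies
  -- inside the ball of radius `r`, where `S` coincides with the epigraph.
  let ζ : ContDiffBump x := ⟨r / 3, r / 2, by positivity, by linarith⟩
  have hζ1 : ContDiff ℝ 1 ζ := ζ.contDiff
  have hBd : ∃ B, ∀ y j, |fderiv ℝ ζ y (basisVec j)| ≤ B := by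
    have hb := fun j => (ζ.hasCompactSupport.fderiv_apply ℝ (basisVec j)).exists_bound_of_continuous
      (continuous_fderiv_apply hζ1 (basisVec j))
    choose B hB using hb
    refine ⟨max (B 0) (B 1), fun y j => (hB j y).trans ?_⟩
    fin_cases j
    · exact le_max_left _ _
    · exact le_max_right _ _
  obtain ⟨B, hB⟩ := hBd
  refine ⟨r / 3, by positivity, C * (3 + 5 * B ^ 2), by positivity, fun v hv hc => ?_⟩
  obtain ⟨u, hu⟩ : ∃ u : Plane → Plane, u = fun y => ζ y • v y := ⟨_, rfl⟩
  have us : ContDiff ℝ ∞ u := by rw [hu]; exact ζ.contDiff.smul hv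
  have uc : HasCompactSupport u := by 
    rw [hu]
    exact HasCompactSupport.intro hc fun y hy => by
      rw [image_eq_zero_of_notMem_tsupport hy, smul_zero]
  have us1 : ContDiff ℝ 1 u := us.of_le (WithTop.coe_le_coe.mpr le_top)
  have vs1 : ContDiff ℝ 1 v := hv.of_le (WithTop.coe_le_coe.mpr le_top)
  have hEm : MeasurableSet (epigraph i j s γ) := (isOpen_epigraph i j s hγ.continuous).measurableSet
  have hsets : S ∩ Metric.ball x r = epigraph i j s γ ∩ Metric.ball x r := by
    ext y
    constructor
    · rintro ⟨h1, h2⟩; exact ⟨(h y h2).mp h1, h2⟩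
    · rintro ⟨h1, h2⟩; exact ⟨(h y h2).mpr h1, h2⟩
  have usupp : ∀ y, y ∉ Metric.ball x r → y ∉ tsupport u := by
    intro y hy hy'
    have h1 : tsupport u ⊆ tsupport ζ := by
      rw [hu]; exact tsupport_smul_subset_left _ _
    have h2 := h1 hy'
    rw [ζ.tsupport_eq] at h2
    exact hy (Metric.closedBall_subset_ball (by change r / 2 < r; linarith) h2)
  have iF := integrable_frob us1 uc
  have iD := integrable_devSq_add us1 uc
  have iDv := integrable_devSq_add vs1 hc
  have s1 : ∫ y in S ∩ Metric.ball x (r / 3), frob (jacobian v y) (jacobian v y) =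
      ∫ y in S ∩ Metric.ball x (r / 3), frob (jacobian u y) (jacobian u y) := by
    refine setIntegral_congr_fun (hS.inter Metric.isOpen_ball.measurableSet) fun y hy => ?_
    have hev : v =ᶠ[nhds y] u := by
      filter_upwards [Metric.isOpen_ball.mem_nhds hy.2] with z hz
      rw [hu]
      simp only
      rw [ζ.one_of_mem_closedBall (Metric.ball_subset_closedBall hz), one_smul]
    have : jacobian v y = jacobian u y := by
      ext a b; simp only [jacobian, Matrix.of_apply, hev.fderiv_eq]
    simp only [this]
  have s2 : ∫ y in S ∩ Metric.ball x (r / 3), frob (jacobian u y) (jacobian u y) ≤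
      ∫ y in epigraph i j s γ, frob (jacobian u y) (jacobian u y) := by
    refine setIntegral_mono_set iF.integrableOn
      (Filter.Eventually.of_forall fun y => frob_self_nonneg _) (LE.le.eventuallyLE ?_)
    intro y hy
    have : y ∈ S ∩ Metric.ball x r := ⟨hy.1, Metric.ball_subset_ball (by linarith) hy.2⟩
    rw [hsets] at this
    exact this.1
  have s3 : ∫ y in epigraph i j s γ, (devSq (jacobian u y) + ‖u y‖ ^ 2) =
      ∫ y in epigraph i j s γ ∩ Metric.ball x r, (devSq (jacobian u y) + ‖u y‖ ^ 2) := by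
    refine setIntegral_eq_of_subset_of_forall_sdiff_eq_zero hEm Set.inter_subset_left ?_
    intro y hy
    have h1 := usupp y fun hb => hy.2 ⟨hy.1, hb⟩
    rw [jacobian_eq_zero h1, image_eq_zero_of_notMem_tsupport h1]
    simp [devSq]
  have s4 : ∫ y in S ∩ Metric.ball x r, (devSq (jacobian u y) + ‖u y‖ ^ 2) ≤
      ∫ y in S ∩ Metric.ball x r, (3 + 5 * B ^ 2) * (devSq (jacobian v y) + ‖v y‖ ^ 2) := by
    refine integral_mono iD.integrableOn (iDv.integrableOn.const_mul _) fun y => ?_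
    rw [hu]
    exact devSq_jacobian_smul_le hζ1 vs1 y (abs_le.mpr ⟨by linarith [ζ.nonneg (x := y)], ζ.le_one⟩)
      (hB y)
  have s5 : ∫ y in S ∩ Metric.ball x r, (devSq (jacobian v y) + ‖v y‖ ^ 2) ≤
      ∫ y in S, (devSq (jacobian v y) + ‖v y‖ ^ 2) := by
    refine setIntegral_mono_set iDv.integrableOn
      (Filter.Eventually.of_forall fun y => ?_)
      (LE.le.eventuallyLE Set.inter_subset_left)
    exact add_nonneg (devSq_nonneg _) (by positivity)
  have s6 := hkorn u us uc
  rw [s3, ← hsets] at s6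
  rw [integral_const_mul] at s4
  have s7 := s4.trans (mul_le_mul_of_nonneg_left s5 (by positivity))
  rw [s1, mul_assoc]
  exact (s2.trans s6).trans (mul_le_mul_of_nonneg_left s7 hC)

/-- The left side is subadditive in `K`, so finitely many of the local balls suffice. -/
theorem korn_of_isLocalEpigraph {S : Set Plane} (hS : MeasurableSet S)
    (h : ∀ x, IsLocalEpigraph S x) {K : Set Plane} (hK : IsCompact K) :
    ∃ C : ℝ, 0 ≤ C ∧ ∀ v : Plane → Plane, ContDiff ℝ ∞ v → HasCompactSupport v →
      ∫ y in S ∩ K, frob (jacobian v y) (jacobian v y) ≤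
        C * ∫ y in S, (devSq (jacobian v y) + ‖v y‖ ^ 2) := by
  have vs1 : ∀ v : Plane → Plane, ContDiff ℝ ∞ v → ContDiff ℝ 1 v :=
    fun v hv => hv.of_le (WithTop.coe_le_coe.mpr le_top)
  refine hK.induction_on (p := fun K => ∃ C : ℝ, 0 ≤ C ∧ ∀ v : Plane → Plane, ContDiff ℝ ∞ v →
    HasCompactSupport v → ∫ y in S ∩ K, frob (jacobian v y) (jacobian v y) ≤
        C * ∫ y in S, (devSq (jacobian v y) + ‖v y‖ ^ 2)) ?_ ?_ ?_ ?_
  · exact ⟨0, le_rfl, fun v _ _ => by simp⟩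
  · rintro s t hst ⟨C, hC, ht⟩
    refine ⟨C, hC, fun v hv hc => le_trans ?_ (ht v hv hc)⟩
    exact setIntegral_mono_set (integrable_frob (vs1 v hv) hc).integrableOn
      (Filter.Eventually.of_forall fun y => frob_self_nonneg _)
      (LE.le.eventuallyLE (Set.inter_subset_inter_right S hst))
  · rintro s t ⟨C, hC, hs⟩ ⟨D, hD, ht⟩
    refine ⟨C + D, by positivity, fun v hv hc => ?_⟩
    have iF := integrable_frob (vs1 v hv) hc
    have e : ∫ y in S ∩ (s ∪ t), frob (jacobian v y) (jacobian v y) ≤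
        (∫ y in S ∩ s, frob (jacobian v y) (jacobian v y)) +
        ∫ y in S ∩ t, frob (jacobian v y) (jacobian v y) := by
      rw [Set.inter_union_distrib_left, ← integral_add_measure iF.integrableOn iF.integrableOn]
      exact integral_mono_measure (Measure.restrict_union_le _ _)
        (Filter.Eventually.of_forall fun y => frob_self_nonneg _)
        (Integrable.add_measure iF.integrableOn iF.integrableOn)
    rw [add_mul]
    exact e.trans (add_le_add (hs v hv hc) (ht v hv hc))
  · intro x _
    obtain ⟨ρ, hρ, C, hC, hk⟩ := (h x).korn hS
    exact ⟨Metric.ball x ρ, mem_nhdsWithin_of_mem_nhds (Metric.ball_mem_nhds x hρ), C, hC, hk⟩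

/-- Strictly above and strictly below the graph are open conditions, so locally the frontier lies on
the graph, which is null. -/
lemma volume_frontier_of_isLocalEpigraph {S : Set Plane} (h : ∀ x, IsLocalEpigraph S x) :
    volume (frontier S) = 0 := by
  refine measure_null_of_locally_null _ fun x _ => ?_
  obtain ⟨r, hr, i, j, hij, s, hs, γ, hγ, h⟩ := h x
  refine ⟨frontier S ∩ Metric.ball x r, inter_mem_nhdsWithin _ (Metric.ball_mem_nhds x hr),
    measure_mono_null ?_ (volume_graph hij hs hγ.continuous)⟩
  rintro y ⟨hy, hyb⟩
  by_contra hne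
  rcases lt_or_gt_of_ne hne with hlt | hgt
  · refine hy.2 (mem_interior_iff_mem_nhds.mpr ?_)
    filter_upwards [(isOpen_epigraph i j s hγ.continuous).mem_nhds hlt,
      Metric.isOpen_ball.mem_nhds hyb] with z hz hzb using (h z hzb).mpr hz
  · have hop : IsOpen {z : Plane | s * z j < γ (z i)} :=
      isOpen_lt (by fun_prop) (hγ.continuous.comp (by fun_prop))
    obtain ⟨z, ⟨hz1, hzb⟩, hzS⟩ := mem_closure_iff.mp hy.1 _ (hop.inter Metric.isOpen_ball)
      ⟨hgt, hyb⟩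
    have hz2 : γ (z i) < s * z j := (h z hzb).mp hzS
    exact lt_asymm hz1 hz2

/-! ### Coercivity on smooth fields -/

lemma jacobian_apply_eq_fderiv {φ : Plane → Plane} (hφ : ContDiff ℝ 1 φ) (i j : Fin 2)
    (x : Plane) : jacobian φ x i j = fderiv ℝ (fun y => φ y i) x (basisVec j) := by
  have h : fderiv ℝ (fun y => φ y i) x = _ :=
    ((EuclideanSpace.proj i : Plane →L[ℝ] ℝ).hasFDerivAt.comp x
      (hφ.differentiable (by norm_num) x).hasFDerivAt).fderiv
  rw [h]
  simp [jacobian]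

/-- The determinant of the Jacobian matrix is a null Lagrangian. -/
lemma integral_det_jacobian {φ : Plane → Plane} (hφ : ContDiff ℝ 2 φ)
    (hc : HasCompactSupport φ) : ∫ x, (jacobian φ x).det = 0 := by
  have hφ1 : ContDiff ℝ 1 φ := hφ.of_le (by norm_num)
  obtain ⟨f, hf⟩ : ∃ f : Fin 2 → Plane → ℝ, f = fun i y => φ y i := ⟨_, rfl⟩
  have fs : ∀ i, ContDiff ℝ 2 (f i) := fun i => by
    rw [hf]; exact (EuclideanSpace.proj i : Plane →L[ℝ] ℝ).contDiff.comp hφ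
  have fs1 : ∀ i, ContDiff ℝ 1 (f i) := fun i => (fs i).of_le (by norm_num)
  have fc : ∀ i, HasCompactSupport (f i) := fun i => by
    rw [hf]; exact hc.comp_left (g := fun v : Plane => v i) rfl
  have hJ : ∀ x i j, jacobian φ x i j = fderiv ℝ (f i) x (basisVec j) := fun x i j => by
    rw [jacobian_apply_eq_fderiv hφ1, hf]
  have hdf : ContDiff ℝ 1 (fderiv ℝ (f 0)) := (fs 0).fderiv_right (by norm_num)
  have ds : ∀ v : Plane, ContDiff ℝ 1 (fun x => fderiv ℝ (f 0) x v) :=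
    fun v => hdf.clm_apply contDiff_const
  have second : ∀ (x v w : Plane), fderiv ℝ (fun x => fderiv ℝ (f 0) x v) x w
      = fderiv ℝ (fderiv ℝ (f 0)) x w v := by
    intro x v w
    have := (hdf.differentiable (by norm_num) x).hasFDerivAt.clm_apply (hasFDerivAt_const v x)
    rw [this.fderiv]
    simp
  have i1 : ∀ v w : Plane, Integrable (fun x => fderiv ℝ (f 0) x v * fderiv ℝ (f 1) x w) :=
    fun v w => by
      have c1 : HasCompactSupport (fun x => fderiv ℝ (f 0) x v * fderiv ℝ (f 1) x w) :=
        ((fc 0).fderiv_apply ℝ v).mul_right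
      exact ((continuous_fderiv_apply (fs1 0) v).mul
        (continuous_fderiv_apply (fs1 1) w)).integrable_of_hasCompactSupport c1
  -- Both products become integrals of a mixed second derivative of `f 0` against `f 1`; symmetry
  -- then cancels them.
  have parts : ∀ v w : Plane, ∫ x, fderiv ℝ (f 0) x v * fderiv ℝ (f 1) x w =
      -∫ x, fderiv ℝ (fderiv ℝ (f 0)) x w v * f 1 x := by
    intro v w
    have c2 : HasCompactSupport (fun x => fderiv ℝ (fun x => fderiv ℝ (f 0) x v) x w * f 1 x) :=
      (fc 1).mul_left
    have c3 : HasCompactSupport (fun x => fderiv ℝ (f 0) x v * f 1 x) := (fc 1).mul_left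
    rw [integral_mul_fderiv_eq_neg_fderiv_mul_of_integrable
      (((continuous_fderiv_apply (ds v) w).mul (fs 1).continuous).integrable_of_hasCompactSupport c2)
      (i1 v w)
      (((ds v).continuous.mul (fs 1).continuous).integrable_of_hasCompactSupport c3)
      (fun x _ => (ds v).differentiable (by norm_num) x)
      (fun x _ => (fs1 1).differentiable (by norm_num) x)]
    simp only [second]
  have e : ∀ x, (jacobian φ x).det = fderiv ℝ (f 0) x (basisVec 0) * fderiv ℝ (f 1) x (basisVec 1)
      - fderiv ℝ (f 0) x (basisVec 1) * fderiv ℝ (f 1) x (basisVec 0) := fun x => by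
    rw [Matrix.det_fin_two, hJ, hJ, hJ, hJ]
  simp only [e]
  rw [integral_sub (i1 _ _) (i1 _ _), parts, parts]
  have : ∀ x, fderiv ℝ (fderiv ℝ (f 0)) x (basisVec 0) (basisVec 1) =
      fderiv ℝ (fderiv ℝ (f 0)) x (basisVec 1) (basisVec 0) := fun x =>
    ((fs 0).contDiffAt (x := x)).isSymmSndFDerivAt (by simp) _ _
  simp only [this, sub_self]

lemma frob_hooke (l m : ℝ) (M : Mat2) : frob (hooke l m M) M =
    l * (M 0 0 + M 1 1) ^ 2 + m * (2 * M 0 0 ^ 2 + 2 * M 1 1 ^ 2 + (M 0 1 + M 1 0) ^ 2) := by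
  simp [frob, hooke, Matrix.trace, Matrix.mul_apply, Fin.sum_univ_two]
  ring

/-- Diagonalisation by trace, trace-free symmetric part and rotation. With `c = μ₁` the middle
coefficient vanishes in phase 1 and the first one in phase 2. -/
lemma frob_hooke_add_det (l m c : ℝ) (M : Mat2) : frob (hooke l m M) M + 4 * c * M.det =
    (l + m + c) * (M 0 0 + M 1 1) ^ 2 + (m - c) * ((M 0 0 - M 1 1) ^ 2 + (M 0 1 + M 1 0) ^ 2) +
      c * (M 0 1 - M 1 0) ^ 2 := by
  rw [frob_hooke, Matrix.det_fin_two]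
  ring

open Classical in
/-- The function with the value `b` on `S` and the value `a` elsewhere. -/
noncomputable def twoValued (S : Set Plane) (a b : ℝ) (x : Plane) : ℝ := if x ∈ S then b else a

lemma measurable_twoValued {S : Set Plane} (hS : MeasurableSet S) (a b : ℝ) :
    Measurable (twoValued S a b) :=
  Measurable.ite hS measurable_const measurable_const

lemma abs_twoValued_le (S : Set Plane) (a b : ℝ) (x : Plane) :
    |twoValued S a b x| ≤ |a| + |b| := by
  unfold twoValued
  split_ifs
  · linarith [abs_nonneg a]
  · linarith [abs_nonneg b]

lemma integrable_twoValued_mul {S : Set Plane} (hS : MeasurableSet S) (a b : ℝ)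
    {μ : Measure Plane} {f : Plane → ℝ} (hf : Integrable f μ) :
    Integrable (fun x => twoValued S a b x * f x) μ :=
  hf.bdd_mul (measurable_twoValued hS a b).aestronglyMeasurable
    (Filter.Eventually.of_forall (abs_twoValued_le S a b))

/-- Integrability of the elastic energy density. -/
lemma integrable_frob_hooke {S : Set Plane} (hS : MeasurableSet S) (l₁ l₂ m₁ m₂ : ℝ)
    {μ : Measure Plane} {G : Plane → Mat2} (hG : ∀ i j, MemLp (fun x => G x i j) 2 μ) :
    Integrable (fun x => frob (hooke (twoValued S l₁ l₂ x) (twoValued S m₁ m₂ x) (G x)) (G x)) μ := by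
  simp only [frob_hooke]
  exact (integrable_twoValued_mul hS l₁ l₂ ((hG 0 0).add (hG 1 1)).integrable_sq).add
    (integrable_twoValued_mul hS m₁ m₂ ((((hG 0 0).integrable_sq.const_mul 2).add
      ((hG 1 1).integrable_sq.const_mul 2)).add ((hG 0 1).add (hG 1 0)).integrable_sq))

lemma integrable_frob_of_memLp {μ : Measure Plane} {G : Plane → Mat2}
    (hG : ∀ i j, MemLp (fun x => G x i j) 2 μ) : Integrable (fun x => frob (G x) (G x)) μ := by
  simp only [frob_self]
  exact (((hG 0 0).integrable_sq.add (hG 0 1).integrable_sq).add (hG 1 0).integrable_sq).add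
    (hG 1 1).integrable_sq

lemma memLp_jacobian {φ : Plane → Plane} (hφ : ContDiff ℝ 1 φ) (hc : HasCompactSupport φ)
    (μ : Measure Plane) [IsFiniteMeasureOnCompacts μ] (i j : Fin 2) :
    MemLp (fun x => jacobian φ x i j) 2 μ :=
  (continuous_jacobian hφ i j).memLp_of_hasCompactSupport
    (hasCompactSupport_jacobian_comp (q := fun _ M => M i j) hc (fun _ => rfl))

lemma le_energy_density_phase_one {l m c c₀ : ℝ} (h1 : c₀ ≤ l + m + c) (h2 : m = c) (h3 : c₀ ≤ c)
    (M : Mat2) : c₀ * (frob M M + 2 * M.det) ≤ frob (hooke l m M) M + 4 * c * M.det := by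
  rw [frob_hooke_add_det, frob_self, Matrix.det_fin_two, h2]
  rw [h2] at h1
  nlinarith only [mul_le_mul_of_nonneg_right h1 (sq_nonneg (M 0 0 + M 1 1)),
    mul_le_mul_of_nonneg_right h3 (sq_nonneg (M 0 1 - M 1 0))]

/-- The second bound holds because the density is nonnegative and `2 det M ≤ |M|²`; its term `2 * c₀
* frob M M` is what the Korn inequality pays for. -/
lemma le_energy_density_phase_two {l m c c₀ : ℝ} (h1 : l + m + c = 0) (h2 : c₀ ≤ m - c)
    (h3 : c₀ ≤ c) (h0 : 0 ≤ c₀) (M : Mat2) :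
    c₀ * devSq M ≤ frob (hooke l m M) M + 4 * c * M.det ∧
    c₀ * (frob M M + 2 * M.det) ≤ frob (hooke l m M) M + 4 * c * M.det + 2 * c₀ * frob M M := by
  rw [frob_hooke_add_det, frob_self, Matrix.det_fin_two, h1, devSq]
  have a := mul_le_mul_of_nonneg_right h2 (sq_nonneg (M 0 0 - M 1 1))
  have b := mul_le_mul_of_nonneg_right h2 (sq_nonneg (M 0 1 + M 1 0))
  have c := mul_le_mul_of_nonneg_right h3 (sq_nonneg (M 0 1 - M 1 0))
  have d := mul_nonneg h0 (sq_nonneg (M 0 0 - M 1 1))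
  have e := mul_nonneg h0 (sq_nonneg (M 0 1 + M 1 0))
  have f := mul_nonneg h0 (sq_nonneg (M 0 1))
  have g := mul_nonneg h0 (sq_nonneg (M 1 0))
  constructor
  · nlinarith only [a, b, c, f, g]
  · nlinarith only [a, b, c, d, e, f, g]

/-- Coercivity of the energy of a two-phase medium on smooth compactly supported fields. -/
theorem coercive_smooth {S : Set Plane} (hS : MeasurableSet S) (h : ∀ x, IsLocalEpigraph S x)
    {Ω : Set Plane} (hΩb : Bornology.IsBounded Ω) {l₁ l₂ m₁ m₂ : ℝ}
    (hpos : 0 < m₁) (heq : l₂ + m₂ + m₁ = 0) (hlt : m₁ < m₂) (hvs : 0 < l₁ + m₁) :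
    ∃ α : ℝ, 0 < α ∧ ∀ φ : Plane → Plane, ContDiff ℝ ∞ φ → HasCompactSupport φ → tsupport φ ⊆ Ω →
      α * ∫ x in Ω, (‖φ x‖ ^ 2 + frob (jacobian φ x) (jacobian φ x)) ≤
        ∫ x in Ω, (frob (hooke (twoValued S l₁ l₂ x) (twoValued S m₁ m₂ x) (jacobian φ x))
          (jacobian φ x) + ‖φ x‖ ^ 2) := by
  obtain ⟨C, hC, hkorn⟩ := korn_of_isLocalEpigraph hS h hΩb.isCompact_closure
  obtain ⟨c₀, hc₀, hc1, hc2, hc3⟩ : ∃ c₀ : ℝ, 0 < c₀ ∧ c₀ ≤ l₁ + m₁ + m₁ ∧ c₀ ≤ m₂ - m₁ ∧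
      c₀ ≤ m₁ :=
    ⟨min (l₁ + m₁ + m₁) (min (m₂ - m₁) m₁), by
      refine lt_min (by linarith) (lt_min (by linarith) hpos), min_le_left _ _,
      (min_le_right _ _).trans (min_le_left _ _), (min_le_right _ _).trans (min_le_right _ _)⟩
  -- Chaining `r2`, `r3` and `r1` below gives `c₀ ∫F ≤ (1 + 2C) ∫Q + 2c₀C ∫N`; the leading 1
  -- accounts for `∫N` itself.
  obtain ⟨A, hA⟩ : ∃ A, A = 1 + (1 + 2 * C + 2 * c₀ * C) / c₀ := ⟨_, rfl⟩
  have hA0 : 0 < A := by rw [hA]; positivity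
  refine ⟨A⁻¹, by positivity, fun φ hφ hc hsupp => ?_⟩
  rw [inv_mul_le_iff₀ hA0]
  have hφ1 : ContDiff ℝ 1 φ := hφ.of_le (WithTop.coe_le_coe.mpr le_top)
  have hφ2 : ContDiff ℝ 2 φ := hφ.of_le (WithTop.coe_le_coe.mpr le_top)
  have hJ := fun i j => memLp_jacobian hφ1 hc (volume : Measure Plane) i j
  obtain ⟨Q, hQ⟩ : ∃ Q : Plane → ℝ, Q = fun x => frob (hooke (twoValued S l₁ l₂ x)
    (twoValued S m₁ m₂ x) (jacobian φ x)) (jacobian φ x) := ⟨_, rfl⟩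
  obtain ⟨F, hF⟩ : ∃ F : Plane → ℝ, F = fun x => frob (jacobian φ x) (jacobian φ x) := ⟨_, rfl⟩
  obtain ⟨D, hD⟩ : ∃ D : Plane → ℝ, D = fun x => devSq (jacobian φ x) := ⟨_, rfl⟩
  obtain ⟨T, hT⟩ : ∃ T : Plane → ℝ, T = fun x => (jacobian φ x).det := ⟨_, rfl⟩
  obtain ⟨N, hN⟩ : ∃ N : Plane → ℝ, N = fun x => ‖φ x‖ ^ 2 := ⟨_, rfl⟩
  have out : ∀ x, x ∉ Ω → jacobian φ x = 0 ∧ φ x = 0 := fun x hx =>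
    ⟨jacobian_eq_zero fun h => hx (hsupp h), image_eq_zero_of_notMem_tsupport fun h => hx (hsupp h)⟩
  have iQ : Integrable Q := by rw [hQ]; exact integrable_frob_hooke hS _ _ _ _ hJ
  have iF : Integrable F := by rw [hF]; exact integrable_frob_of_memLp hJ
  have iN : Integrable N := by
    have h2 : Continuous (fun y => ‖φ y‖ ^ 2) := hφ.continuous.norm.pow 2
    rw [hN]; exact h2.integrable_of_hasCompactSupport (hasCompactSupport_norm_sq hc)
  have iD : Integrable D := by
    have := (integrable_devSq_add hφ1 hc).sub iN
    rw [hN] at this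
    rw [hD]
    refine this.congr (Filter.Eventually.of_forall fun x => ?_)
    simp
  have iT : Integrable T := by
    rw [hT]
    simp only [Matrix.det_fin_two]
    exact ((hJ 0 0).integrable_mul (hJ 1 1)).sub ((hJ 0 1).integrable_mul (hJ 1 0))
  have intT : ∫ x, T x = 0 := by rw [hT]; exact integral_det_jacobian hφ2 hc
  have hF0 : ∀ x, 0 ≤ F x := fun x => by rw [hF]; exact frob_self_nonneg _
  have hN0 : ∀ x, 0 ≤ N x := fun x => by rw [hN]; positivity
  have onΩ : ∀ f : Plane → ℝ, (∀ x, x ∉ Ω → f x = 0) → ∫ x in Ω, f x = ∫ x, f x := fun f hf =>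
    setIntegral_eq_integral_of_forall_compl_eq_zero hf
  have iQN : ∫ x in Ω, (Q x + N x) = (∫ x, Q x) + ∫ x, N x := by
    rw [onΩ, integral_add iQ iN]
    intro x hx
    rw [hQ, hN]
    simp [(out x hx).1, (out x hx).2, frob]
  have iNF : ∫ x in Ω, (N x + F x) = (∫ x, N x) + ∫ x, F x := by
    rw [onΩ, integral_add iN iF]
    intro x hx
    rw [hF, hN]
    simp [(out x hx).1, (out x hx).2, frob]
  have p1 : ∀ x, S.indicator (fun x => c₀ * D x) x ≤ Q x + 4 * m₁ * T x := by
    intro x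
    rw [hQ, hT, hD]
    by_cases hx : x ∈ S
    · simp only [Set.indicator_of_mem hx, twoValued, if_pos hx]
      exact (le_energy_density_phase_two heq hc2 hc3 hc₀.le _).1
    · simp only [Set.indicator_of_notMem hx, twoValued, if_neg hx, frob_hooke_add_det]
      have : 0 ≤ l₁ + m₁ + m₁ := by linarith
      rw [sub_self, zero_mul, add_zero]
      positivity
  have p2 : ∀ x, c₀ * (F x + 2 * T x) ≤
      Q x + 4 * m₁ * T x + S.indicator (fun x => 2 * c₀ * F x) x := by
    intro x
    rw [hQ, hT, hF]
    by_cases hx : x ∈ S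
    · simp only [Set.indicator_of_mem hx, twoValued, if_pos hx]
      exact (le_energy_density_phase_two heq hc2 hc3 hc₀.le _).2
    · simp only [Set.indicator_of_notMem hx, twoValued, if_neg hx, add_zero]
      exact le_energy_density_phase_one hc1 rfl hc3 _
  have iQT : ∫ x, (Q x + 4 * m₁ * T x) = ∫ x, Q x := by
    rw [integral_add iQ (iT.const_mul _), integral_const_mul, intT, mul_zero, add_zero]
  have q1 := integral_mono ((iD.const_mul c₀).indicator hS) (iQ.add (iT.const_mul (4 * m₁))) p1
  have q2 := integral_mono ((iF.add (iT.const_mul 2)).const_mul c₀)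
    ((iQ.add (iT.const_mul (4 * m₁))).add ((iF.const_mul (2 * c₀)).indicator hS)) p2
  have r1 : c₀ * ∫ x in S, D x ≤ ∫ x, Q x := by
    rw [← integral_const_mul, ← integral_indicator hS, ← iQT]
    exact q1
  have r2 : c₀ * ∫ x, F x ≤ (∫ x, Q x) + 2 * c₀ * ∫ x in S, F x := by
    -- Second use of the null Lagrangian: the squares of divergence and curl have the same total
    -- integral as the whole gradient squared.
    have e1 : ∫ x, c₀ * (F x + 2 * T x) = c₀ * ∫ x, F x := by
      rw [integral_const_mul, integral_add iF (iT.const_mul 2), integral_const_mul, intT, mul_zero,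
        add_zero]
    have e2 : ∫ x, (Q x + 4 * m₁ * T x + S.indicator (fun x => 2 * c₀ * F x) x) =
        (∫ x, Q x) + 2 * c₀ * ∫ x in S, F x := by
      have i : Integrable (fun x => Q x + 4 * m₁ * T x) := iQ.add (iT.const_mul (4 * m₁))
      rw [integral_add i ((iF.const_mul (2 * c₀)).indicator hS), integral_indicator hS,
        integral_const_mul, iQT]
    rw [← e1, ← e2]
    exact q2
  have r3 : ∫ x in S, F x ≤ C * ((∫ x in S, D x) + ∫ x, N x) := by
    have k := hkorn φ hφ hc
    have e1 : ∫ x in S, F x = ∫ x in S ∩ closure Ω, F x := by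
      refine setIntegral_eq_of_subset_of_forall_sdiff_eq_zero hS Set.inter_subset_left ?_
      intro x hx
      have hx' : x ∉ Ω := fun h' => hx.2 ⟨hx.1, subset_closure h'⟩
      rw [hF]
      simp [(out x hx').1, frob]
    have e2 : ∫ x in S, (D x + N x) ≤ (∫ x in S, D x) + ∫ x, N x := by
      rw [integral_add iD.integrableOn iN.integrableOn]
      exact add_le_add_right
        (setIntegral_le_integral iN (Filter.Eventually.of_forall hN0)) _
    rw [e1]
    refine le_trans ?_ (mul_le_mul_of_nonneg_left e2 hC)
    rw [hF, hD, hN]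
    exact k
  have hQN : ∫ x in Ω, (frob (hooke (twoValued S l₁ l₂ x) (twoValued S m₁ m₂ x) (jacobian φ x))
          (jacobian φ x) + ‖φ x‖ ^ 2) = ∫ x in Ω, (Q x + N x) := by rw [hQ, hN]
  have hNF : ∫ x in Ω, (‖φ x‖ ^ 2 + frob (jacobian φ x) (jacobian φ x)) =
      ∫ x in Ω, (N x + F x) := by rw [hF, hN]
  rw [hQN, hNF, iQN, iNF, hA]
  have hNi : 0 ≤ ∫ x, N x := integral_nonneg hN0
  have hDi : 0 ≤ ∫ x in S, D x := integral_nonneg fun x => by rw [hD]; exact devSq_nonneg _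
  have hQi : 0 ≤ ∫ x, Q x := le_trans (by positivity) r1
  generalize (∫ x, N x) = n at *
  generalize (∫ x, Q x) = q at *
  generalize (∫ x in S, D x) = d at *
  generalize (∫ x in S, F x) = fS at *
  generalize (∫ x, F x) = f at *
  have t1 : c₀ * f ≤ (1 + 2 * C + 2 * c₀ * C) * (q + n) := by
    have u1 := mul_le_mul_of_nonneg_left r3 (by positivity : 0 ≤ 2 * c₀)
    have u2 := mul_le_mul_of_nonneg_left r1 (by positivity : 0 ≤ 2 * C)
    have u3 : 0 ≤ C * n := by positivity
    have u4 : 0 ≤ c₀ * (C * q) := by positivity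
    nlinarith only [r2, u1, u2, u3, u4, hNi]
  have t2 : f ≤ (1 + 2 * C + 2 * c₀ * C) / c₀ * (q + n) := by
    rw [div_mul_eq_mul_div, le_div_iff₀ hc₀]
    linarith
  linarith

/-! ### Passage to `H¹₀` by density -/

/-- Young's inequality with weight `θ` on the cross term of `z² - y²`; the sign of `κ` is free, as
the coefficients of the energy may be negative. -/
lemma mul_sq_le_of_abs_le {κ B θ : ℝ} (hκ : |κ| ≤ B) (hθ : 0 < θ) (y z : ℝ) :
    κ * z ^ 2 ≤ κ * y ^ 2 + B * (θ * y ^ 2 + (1 + θ⁻¹) * (y - z) ^ 2) := by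
  have hB : 0 ≤ B := (abs_nonneg κ).trans hκ
  have h1 : κ * (z ^ 2 - y ^ 2) ≤ B * |z ^ 2 - y ^ 2| :=
    (le_abs_self _).trans (by rw [abs_mul]; exact mul_le_mul_of_nonneg_right hκ (abs_nonneg _))
  have hy : ∀ w : ℝ, 2 * (y * w) ≤ θ * y ^ 2 + θ⁻¹ * w ^ 2 := fun w => by
    have e : θ * y ^ 2 + θ⁻¹ * w ^ 2 - 2 * (y * w) = θ * (y - θ⁻¹ * w) ^ 2 := by
      field_simp
      ring
    have : 0 ≤ θ * (y - θ⁻¹ * w) ^ 2 := by positivity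
    linarith
  have h2 : |z ^ 2 - y ^ 2| ≤ θ * y ^ 2 + (1 + θ⁻¹) * (y - z) ^ 2 := by
    have a := hy (y - z)
    have b := hy (-(y - z))
    rw [neg_sq] at b
    rw [abs_le]
    constructor
    · linarith only [a, sq_nonneg (y - z)]
    · linarith only [b]
  linarith [mul_le_mul_of_nonneg_left h2 hB]

/-- The integrand of the difference of the energy and a multiple of the square of the
`H¹` norm. -/
noncomputable def energyGap (l m α : ℝ) (v : Plane) (M : Mat2) : ℝ :=
  frob (hooke l m M) M + ‖v‖ ^ 2 - α * (‖v‖ ^ 2 + frob M M)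

/-- Quantitative continuity of the quadratic form. The factor 5 is the worst case, that of a
diagonal entry: 2 from the trace square, 2 from the `m` term, 1 from the `α` term. -/
lemma energyGap_le {l m α B θ : ℝ} (hl : |l| ≤ B) (hm : |m| ≤ B) (hα : |α| ≤ B)
    (hα' : |1 - α| ≤ B) (hθ : 0 < θ) (v w : Plane) (M P : Mat2) :
    energyGap l m α w P ≤ energyGap l m α v M + 5 * B * θ * (‖v‖ ^ 2 + frob M M) +
      5 * B * (1 + θ⁻¹) * (‖v - w‖ ^ 2 + frob (M - P) (M - P)) := by
  have hB : 0 ≤ B := (abs_nonneg l).trans hl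
  unfold energyGap
  simp only [frob_hooke, frob_self, norm_sq_plane, PiLp.sub_apply, Matrix.sub_apply]
  generalize M 0 0 = a
  generalize M 0 1 = b
  generalize M 1 0 = c
  generalize M 1 1 = d
  generalize P 0 0 = a'
  generalize P 0 1 = b'
  generalize P 1 0 = c'
  generalize P 1 1 = d'
  generalize v 0 = v₀
  generalize v 1 = v₁
  generalize w 0 = w₀
  generalize w 1 = w₁
  rw [← abs_neg] at hα
  obtain ⟨t, ht⟩ : ∃ t, t = 1 + θ⁻¹ := ⟨_, rfl⟩
  have ht0 : 0 ≤ t := by rw [ht]; positivity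
  have k1 := mul_sq_le_of_abs_le hl hθ (a + d) (a' + d')
  have k2 := mul_sq_le_of_abs_le hm hθ a a'
  have k3 := mul_sq_le_of_abs_le hm hθ d d'
  have k4 := mul_sq_le_of_abs_le hm hθ (b + c) (b' + c')
  have k5 := mul_sq_le_of_abs_le hα' hθ v₀ w₀
  have k6 := mul_sq_le_of_abs_le hα' hθ v₁ w₁
  have k7 := mul_sq_le_of_abs_le hα hθ a a'
  have k8 := mul_sq_le_of_abs_le hα hθ b b'
  have k9 := mul_sq_le_of_abs_le hα hθ c c'
  have k10 := mul_sq_le_of_abs_le hα hθ d d'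
  rw [← ht] at *
  have hBθ : 0 ≤ B * θ := by positivity
  have hBt : 0 ≤ B * t := by positivity
  have m1 := mul_nonneg hBθ (sq_nonneg (a - d))
  have m2 := mul_nonneg hBθ (sq_nonneg (b - c))
  have m3 := mul_nonneg hBt (sq_nonneg ((a - a') - (d - d')))
  have m4 := mul_nonneg hBt (sq_nonneg ((b - b') - (c - c')))
  have n1 := mul_nonneg hBθ (sq_nonneg b)
  have n2 := mul_nonneg hBθ (sq_nonneg c)
  have n3 := mul_nonneg hBθ (sq_nonneg v₀)
  have n4 := mul_nonneg hBθ (sq_nonneg v₁)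
  have n5 := mul_nonneg hBt (sq_nonneg (b - b'))
  have n6 := mul_nonneg hBt (sq_nonneg (c - c'))
  have n7 := mul_nonneg hBt (sq_nonneg (v₀ - w₀))
  have n8 := mul_nonneg hBt (sq_nonneg (v₁ - w₁))
  linarith only [k1, k2, k3, k4, k5, k6, k7, k8, k9, k10, m1, m2, m3, m4, n1, n2, n3, n4, n5, n6,
    n7, n8]

lemma isL2WeakGrad_weakGrad {Ω : Set Plane} {v : L2 Ω} (hv : v ∈ H1 Ω) :
    IsL2WeakGrad Ω v (weakGrad Ω v) := by
  have h : ∃ G, IsL2WeakGrad Ω v G := hv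
  rw [weakGrad, dif_pos h]
  exact h.choose_spec

/-- The order of limits matters: `δ → 0` at fixed `θ`, then `θ → 0`, because `θ⁻¹` multiplies `δ`.
-/
lemma nonneg_of_forall_small {x a b : ℝ}
    (h : ∀ θ δ : ℝ, 0 < θ → 0 < δ → -(θ * a) - (1 + θ⁻¹) * b * δ ≤ x) : 0 ≤ x := by
  have h1 : ∀ θ : ℝ, 0 < θ → -(θ * a) ≤ x := by
    intro θ hθ
    have hlim : Filter.Tendsto (fun δ : ℝ => -(θ * a) - (1 + θ⁻¹) * b * δ)
        (nhdsWithin 0 (Set.Ioi 0)) (nhds (-(θ * a) - (1 + θ⁻¹) * b * 0)) :=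
      (Continuous.tendsto (by fun_prop) 0).mono_left nhdsWithin_le_nhds
    rw [mul_zero, sub_zero] at hlim
    exact le_of_tendsto hlim (Filter.eventually_of_mem self_mem_nhdsWithin fun δ hδ => h θ δ hθ hδ)
  have hlim : Filter.Tendsto (fun θ : ℝ => -(θ * a)) (nhdsWithin 0 (Set.Ioi 0))
      (nhds (-(0 * a))) :=
    (Continuous.tendsto (by fun_prop) 0).mono_left nhdsWithin_le_nhds
  rw [zero_mul, neg_zero] at hlim
  exact le_of_tendsto hlim (Filter.eventually_of_mem self_mem_nhdsWithin fun θ hθ => h1 θ hθ)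

/-- A coercivity inequality valid for smooth fields extends to `H¹₀`. -/
theorem coercive_of_smooth {S : Set Plane} (hS : MeasurableSet S) {Ω : Set Plane}
    {l₁ l₂ m₁ m₂ α : ℝ}
    (h : ∀ φ : Plane → Plane, ContDiff ℝ ∞ φ → HasCompactSupport φ → tsupport φ ⊆ Ω →
      α * ∫ x in Ω, (‖φ x‖ ^ 2 + frob (jacobian φ x) (jacobian φ x)) ≤
        ∫ x in Ω, (frob (hooke (twoValued S l₁ l₂ x) (twoValued S m₁ m₂ x) (jacobian φ x))
          (jacobian φ x) + ‖φ x‖ ^ 2))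
    {v : L2 Ω} (hv : v ∈ H10 Ω) :
    α * ∫ x in Ω, (‖v x‖ ^ 2 + frob (weakGrad Ω v x) (weakGrad Ω v x)) ≤
      ∫ x in Ω, (frob (hooke (twoValued S l₁ l₂ x) (twoValued S m₁ m₂ x) (weakGrad Ω v x))
        (weakGrad Ω v x) + ‖v x‖ ^ 2) := by
  obtain ⟨hv1, happ⟩ := hv
  have hG : ∀ i j, MemLp (fun x => weakGrad Ω v x i j) 2 (volume.restrict Ω) :=
    fun i j => (isL2WeakGrad_weakGrad hv1 i j).2
  generalize weakGrad Ω v = G at *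
  have hvL : MemLp v 2 (volume.restrict Ω) := Lp.memLp v
  have gap : ∀ (w : Plane → Plane) (P : Plane → Mat2), MemLp w 2 (volume.restrict Ω) →
      (∀ i j, MemLp (fun x => P x i j) 2 (volume.restrict Ω)) →
      IntegrableOn (fun x => ‖w x‖ ^ 2 + frob (P x) (P x)) Ω ∧
      IntegrableOn (fun x => energyGap (twoValued S l₁ l₂ x) (twoValued S m₁ m₂ x) α (w x) (P x)) Ω ∧
      ∫ x in Ω, energyGap (twoValued S l₁ l₂ x) (twoValued S m₁ m₂ x) α (w x) (P x) =
        (∫ x in Ω, (frob (hooke (twoValued S l₁ l₂ x) (twoValued S m₁ m₂ x) (P x)) (P x) +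
          ‖w x‖ ^ 2)) - α * ∫ x in Ω, (‖w x‖ ^ 2 + frob (P x) (P x)) := by
    intro w P hw hP
    have i1 : IntegrableOn (fun x => ‖w x‖ ^ 2 + frob (P x) (P x)) Ω :=
      (hw.integrable_norm_pow two_ne_zero).add (integrable_frob_of_memLp hP)
    have i2 : IntegrableOn (fun x => frob (hooke (twoValued S l₁ l₂ x) (twoValued S m₁ m₂ x) (P x))
        (P x) + ‖w x‖ ^ 2) Ω :=
      (integrable_frob_hooke hS _ _ _ _ hP).add (hw.integrable_norm_pow two_ne_zero)
    refine ⟨i1, i2.sub (i1.const_mul α), ?_⟩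
    unfold energyGap
    rw [integral_sub i2 (i1.const_mul α), integral_const_mul]
  obtain ⟨i1, i2, e⟩ := gap v G hvL hG
  rw [← sub_nonneg, ← e]
  obtain ⟨B, hB⟩ : ∃ B, B = |l₁| + |l₂| + |m₁| + |m₂| + |α| + |1 - α| := ⟨_, rfl⟩
  have b1 := abs_nonneg l₁
  have b2 := abs_nonneg l₂
  have b3 := abs_nonneg m₁
  have b4 := abs_nonneg m₂
  have b5 := abs_nonneg α
  have b6 := abs_nonneg (1 - α)
  have hB0 : 0 ≤ B := by rw [hB]; positivity
  refine nonneg_of_forall_small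
    (a := 5 * B * ∫ x in Ω, (‖v x‖ ^ 2 + frob (G x) (G x))) (b := 5 * B) ?_
  intro θ δ hθ hδ
  obtain ⟨φ, hφ, hc, hsupp, hδφ⟩ := happ δ hδ
  have hφ1 : ContDiff ℝ 1 φ := hφ.of_le (WithTop.coe_le_coe.mpr le_top)
  have hφL : MemLp φ 2 (volume.restrict Ω) := hφ.continuous.memLp_of_hasCompactSupport hc
  have hJ := fun i j => memLp_jacobian hφ1 hc (volume.restrict Ω) i j
  obtain ⟨-, j2, e'⟩ := gap φ (jacobian φ) hφL hJ
  obtain ⟨k1, -, -⟩ := gap (fun x => v x - φ x) (fun x => G x - jacobian φ x) (hvL.sub hφL)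
    (fun i j => (hG i j).sub (hJ i j))
  have hpos := sub_nonneg.mpr (h φ hφ hc hsupp)
  rw [← e'] at hpos
  have point : ∀ x, energyGap (twoValued S l₁ l₂ x) (twoValued S m₁ m₂ x) α (φ x) (jacobian φ x) ≤
      energyGap (twoValued S l₁ l₂ x) (twoValued S m₁ m₂ x) α (v x) (G x) +
      5 * B * θ * (‖v x‖ ^ 2 + frob (G x) (G x)) + 5 * B * (1 + θ⁻¹) *
      (‖v x - φ x‖ ^ 2 + frob (G x - jacobian φ x) (G x - jacobian φ x)) := fun x =>
    energyGap_le ((abs_twoValued_le _ _ _ _).trans (by linarith))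
      ((abs_twoValued_le _ _ _ _).trans (by linarith)) (by linarith) (by linarith) hθ _ _ _ _
  have i12 : IntegrableOn (fun x => energyGap (twoValued S l₁ l₂ x) (twoValued S m₁ m₂ x) α (v x)
      (G x) + 5 * B * θ * (‖v x‖ ^ 2 + frob (G x) (G x))) Ω := i2.add (i1.const_mul _)
  have int := integral_mono j2 (i12.add (k1.const_mul (5 * B * (1 + θ⁻¹)))) point
  have eR : ∫ x in Ω, (energyGap (twoValued S l₁ l₂ x) (twoValued S m₁ m₂ x) α (v x) (G x) +
      5 * B * θ * (‖v x‖ ^ 2 + frob (G x) (G x)) + 5 * B * (1 + θ⁻¹) *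
      (‖v x - φ x‖ ^ 2 + frob (G x - jacobian φ x) (G x - jacobian φ x))) =
      (∫ x in Ω, energyGap (twoValued S l₁ l₂ x) (twoValued S m₁ m₂ x) α (v x) (G x)) +
      5 * B * θ * (∫ x in Ω, (‖v x‖ ^ 2 + frob (G x) (G x))) + 5 * B * (1 + θ⁻¹) *
      ∫ x in Ω, (‖v x - φ x‖ ^ 2 + frob (G x - jacobian φ x) (G x - jacobian φ x)) := by
    rw [integral_add i12 (k1.const_mul _), integral_add i2 (i1.const_mul _), integral_const_mul,
      integral_const_mul]
  have int' := hpos.trans (int.trans_eq eR)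
  have small := mul_le_mul_of_nonneg_left hδφ.le (by positivity : 0 ≤ 5 * B * (1 + θ⁻¹))
  linarith only [int', small]

/-! ### The two phases -/

lemma continuous_toTorus : Continuous toTorus := by
  unfold toTorus
  exact continuous_pi fun i => (AddCircle.continuous_mk' 1).comp (by fun_prop)

lemma isOpenMap_toTorus : IsOpenMap toTorus := by
  have h : IsOpenMap (Pi.map (fun (_ : Fin 2) (t : ℝ) => (t : UnitAddCircle))) :=
    IsOpenMap.piMap (fun _ => QuotientAddGroup.isOpenMap_coe) (by simp)
  exact h.comp (EuclideanSpace.equiv (Fin 2) ℝ).toHomeomorph.isOpenMap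

/-- The part of the plane occupied by the phase `Z` in the medium of period `ε`. -/
def phase (ε : ℝ) (Z : Set Torus2) : Set Plane := (fun x => ε⁻¹ • x) ⁻¹' (toTorus ⁻¹' Z)

lemma IsC2Open.isLocalEpigraph {Z : Set Torus2} (hZ : IsC2Open Z) {ε : ℝ} (hε : 0 < ε)
    (x : Plane) : IsLocalEpigraph (phase ε Z) x :=
  (hZ.2.isLocalEpigraph _).preimage_smul hε

lemma IsC2Open.isOpen_phase {Z : Set Torus2} (hZ : IsC2Open Z) (ε : ℝ) :
    IsOpen (phase ε Z) :=
  (hZ.1.preimage continuous_toTorus).preimage (by fun_prop)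

/-- The scaled projection is open and continuous, so taking closures commutes with preimages. -/
lemma phase_closure_diff_subset {Z : Set Torus2} (hZ : IsC2Open Z) {ε : ℝ} (hε : 0 < ε) :
    phase ε (closure Z) \ phase ε Z ⊆ frontier (phase ε Z) := by
  have ho : IsOpenMap (fun x : Plane => toTorus (ε⁻¹ • x)) :=
    isOpenMap_toTorus.comp (isOpenMap_smul₀ (inv_ne_zero hε.ne'))
  have hc : Continuous (fun x : Plane => toTorus (ε⁻¹ • x)) := continuous_toTorus.comp (by fun_prop)
  rw [(hZ.isOpen_phase ε).frontier_eq]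
  exact Set.sdiff_subset_sdiff_left (ho.preimage_closure_eq_closure_preimage hc Z).le

lemma ae_mem_phase {Z₁ Z₂ : Set Torus2} (hgeo : Geometry Z₁ Z₂) {ε : ℝ} (hε : 0 < ε) :
    ∀ᵐ x : Plane, x ∈ phase ε Z₁ ∨ x ∈ phase ε Z₂ := by
  have n1 := volume_frontier_of_isLocalEpigraph (hgeo.c2_one.isLocalEpigraph hε)
  have n2 := volume_frontier_of_isLocalEpigraph (hgeo.c2_two.isLocalEpigraph hε)
  filter_upwards [measure_eq_zero_iff_ae_notMem.mp n1, measure_eq_zero_iff_ae_notMem.mp n2]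
    with x h1 h2
  by_contra hx
  rw [not_or] at hx
  have hcov : toTorus (ε⁻¹ • x) ∈ closure Z₁ ∪ closure Z₂ := by rw [hgeo.cover]; trivial
  rcases hcov with hc | hc
  · exact h1 (phase_closure_diff_subset hgeo.c2_one hε ⟨hc, hx.1⟩)
  · exact h2 (phase_closure_diff_subset hgeo.c2_two hε ⟨hc, hx.2⟩)

lemma Lame.ae_eq_twoValued {Z₁ Z₂ : Set Torus2} (hgeo : Geometry Z₁ Z₂) {lam mu : Torus2 → ℝ}
    {lam₁ lam₂ mu₁ mu₂ : ℝ} (hlame : Lame Z₁ Z₂ lam mu lam₁ lam₂ mu₁ mu₂) {ε : ℝ} (hε : 0 < ε) :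
    ∀ᵐ x : Plane, lam (toTorus (ε⁻¹ • x)) = twoValued (phase ε Z₂) lam₁ lam₂ x ∧
      mu (toTorus (ε⁻¹ • x)) = twoValued (phase ε Z₂) mu₁ mu₂ x := by
  filter_upwards [ae_mem_phase hgeo hε] with x hx
  by_cases h2 : x ∈ phase ε Z₂
  · simp only [twoValued, if_pos h2]
    exact hlame.phase_two _ h2
  · simp only [twoValued, if_neg h2]
    exact hlame.phase_one _ (hx.resolve_right h2)

/-- The constant is not uniform in `ε`: it comes from a Korn inequality for the phase at scale `ε`.
-/
theorem exists_coercive {Ω : Set Plane} (hΩb : Bornology.IsBounded Ω)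
    {Z₁ Z₂ : Set Torus2} (hgeo : Geometry Z₁ Z₂) {lam mu : Torus2 → ℝ} {lam₁ lam₂ mu₁ mu₂ : ℝ}
    (hlame : Lame Z₁ Z₂ lam mu lam₁ lam₂ mu₁ mu₂) {ε : ℝ} (hε : 0 < ε) :
    ∃ α : ℝ, 0 < α ∧ ∀ v ∈ H10 Ω,
      ((α * ∫ x in Ω, (‖v x‖ ^ 2 + frob (weakGrad Ω v x) (weakGrad Ω v x)) : ℝ) : EReal)
        ≤ energy Ω lam mu ε v := by
  have hS := (hgeo.c2_two.isOpen_phase ε).measurableSet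
  have hpos := hlame.pos
  have heq := hlame.eq
  obtain ⟨α, hα, h⟩ := coercive_smooth hS (hgeo.c2_two.isLocalEpigraph hε) hΩb
    (l₁ := lam₁) (l₂ := lam₂) (m₁ := mu₁) (m₂ := mu₂) (by linarith) (by linarith) hlame.lt
    hlame.very_strong
  refine ⟨α, hα, fun v hv => ?_⟩
  rw [energy, if_pos hv]
  refine EReal.coe_le_coe_iff.mpr ((coercive_of_smooth hS h hv).trans (le_of_eq ?_))
  refine integral_congr_ae (ae_restrict_of_ae ?_)
  filter_upwards [hlame.ae_eq_twoValued hgeo hε] with x hx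
  rw [hx.1, hx.2]

end TwoPhase

theorem lemma4p1 (Ω : Set TwoPhase.Plane) (hΩ : IsOpen Ω) (hΩb : Bornology.IsBounded Ω)
    (Z₁ Z₂ : Set TwoPhase.Torus2) (hgeo : TwoPhase.Geometry Z₁ Z₂)
    (lam mu : TwoPhase.Torus2 → ℝ) (lam₁ lam₂ mu₁ mu₂ : ℝ)
    (hlame : TwoPhase.Lame Z₁ Z₂ lam mu lam₁ lam₂ mu₁ mu₂) :
    ∃ α : ℝ → ℝ, (∀ ε : ℝ, 0 < ε → 0 < α ε) ∧
      ∀ ε : ℝ, 0 < ε → ∀ v ∈ TwoPhase.H10 Ω,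
        ((α ε * ∫ x in Ω, (‖v x‖ ^ 2 +
          TwoPhase.frob (TwoPhase.weakGrad Ω v x) (TwoPhase.weakGrad Ω v x)) : ℝ) : EReal)
        ≤ TwoPhase.energy Ω lam mu ε v := by
  choose! α hα h using fun (ε : ℝ) (hε : 0 < ε) =>
    TwoPhase.exists_coercive hΩb hgeo hlame hε
  exact ⟨α, hα, h⟩
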